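/- Let $k$ be a field, let $n_1,\dots,n_m\ge 1$ be integers, and let $Y=\mathbb{P}^{n_1}_k\times_k\dots\times_k\mathbb{P}^{n_m}_k$. Let $R=k[x_{i,j}: 1\le i\le m,\ 0\le j\le n_i]$ be its Cox ring, graded by $\mathrm{Pic}(Y)\cong\mathbb{Z}^m$ with $\deg x_{i,j}=e_i$ (the $i$-th standard basis vector), and let $G=\prod_{i=1}^m(x_{i,0},\dots,x_{i,n_i})$ be its irrelevant ideal. For a multihomogeneous $f\in R$ let $\mathcal{O}_Y(-D_f)\subseteq\mathcal{O}_Y$ be the ideal sheaf of the hypersurface $D_f=\{f=0\}$, i.e. the ideal sheaf which on each standard affine chart $\{x_{1,j_1}\cdots x_{m,j_m}\ne 0\}$ is generated by the dehomogenization of $f$ (obtained by setting $x_{i,j_i}=1$ for all $i$). Let $s\ge 0$ be an integer with $s\le n_i$ for all $i$, and let $f_1,\dots,f_s\in R$ be multihomogeneous polynomials that define a complete intersection of codimension $s$ in $Y$; that is, the (not necessarily reduced) closed subscheme $X\subseteq Y$ with ideal sheaf $\mathscr{I}_X=\mathcal{O}_Y(-D_{f_1})+\dots+\mathcal{O}_Y(-D_{f_s})$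 satisfies $\dim X+s=\dim Y$ (where $\dim\emptyset=-\infty$). Then: 1. The ideal $I=(f_1,\dots,f_s)$ of $R$ is saturated with respect to $G$, i.e. $(I:G^\infty)=I$, where $(I:G^\infty)=\{r\in R: rG^N\subseteq I\text{ for some }N\ge 0\}$. 2. Hence $X$ is a strict complete intersection, with respect to $R$, of the hypersurfaces defined by $f_1,\dots,f_s$; that is, $X$ is the complete intersection of these hypersurfaces, and the ideal of $X$ in the Cox ring, namely the ideal of $R$ generated by all multihomogeneous $f\in R$ with $\mathcal{O}_Y(-D_f)\subseteq\mathscr{I}_X$, is equal to $(f_1,\dots,f_s)$. -/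

import Mathlib

open AlgebraicGeometry CategoryTheory

universe u

noncomputable section

/-! ### Ideals and complete intersections in general -/

/-- The saturation `(I : G^∞)`: all `r` with `r G^N ⊆ I` for some `N`. -/
def Ideal.saturationBy {R : Type*} [CommRing R] (I G : Ideal R) : Ideal R where
  carrier := {r | ∃ N : ℕ, ∀ g ∈ G ^ N, r * g ∈ I}
  zero_mem' := ⟨0, fun g _ => by simp⟩
  add_mem' := by
    rintro a b ⟨M, hM⟩ ⟨N, hN⟩
    refine ⟨M + N, fun g hg => ?_⟩
    rw [add_mul]
    exact I.add_mem (hM g (Ideal.pow_le_pow_right (Nat.le_add_right M N) hg))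
      (hN g (Ideal.pow_le_pow_right (Nat.le_add_left N M) hg))
  smul_mem' := by
    rintro c a ⟨N, hN⟩
    refine ⟨N, fun g hg => ?_⟩
    rw [smul_eq_mul, mul_assoc]
    exact I.mul_mem_left c (hN g hg)

/-- `I` is saturated with respect to `G`. -/
def Ideal.IsSaturatedBy {R : Type*} [CommRing R] (I G : Ideal R) : Prop :=
  I.saturationBy G = I

/-- The closed subscheme with ideal sheaf `X` is the (scheme-theoretic) complete intersection
in `Y` of the `s` closed subschemes with ideal sheaves `H a`:
`𝓘_X = 𝓘_{H_1} + ⋯ + 𝓘_{H_s}` and `dim X + s = dim Y`.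
(The empty scheme has dimension `⊥`, so it is never a complete intersection in a nonempty `Y`.) -/
def AlgebraicGeometry.Scheme.IdealSheafData.IsCompleteIntersection {Y : Scheme.{u}} {s : ℕ}
    (X : Y.IdealSheafData) (H : Fin s → Y.IdealSheafData) : Prop :=
  X = ⨆ a, H a ∧ topologicalKrullDim X.subscheme + s = topologicalKrullDim Y

/-! ### Projective spaces and their products over a field -/

namespace MultiProj

attribute [local instance] MvPolynomial.gradedAlgebra

variable (k : Type u) [Field k]

/-- Projective space `ℙ^n` over `k`, as `Proj k[x_0, …, x_n]` with the standard grading. -/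
abbrev projSpace (n : ℕ) : Scheme.{u} :=
  Proj (MvPolynomial.homogeneousSubmodule (Fin (n + 1)) k)

lemma X_mem_homogeneousSubmodule {n : ℕ} (l : Fin (n + 1)) :
    (MvPolynomial.X l : MvPolynomial (Fin (n + 1)) k) ∈
      MvPolynomial.homogeneousSubmodule (Fin (n + 1)) k 1 :=
  MvPolynomial.isHomogeneous_X k l

/-- The structure morphism `ℙ^n ⟶ Spec k`. -/
def projSpaceStr (n : ℕ) : projSpace k n ⟶ Spec (CommRingCat.of k) :=
  Proj.toSpecZero (MvPolynomial.homogeneousSubmodule (Fin (n + 1)) k) ≫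
    Spec.map (CommRingCat.ofHom
      (algebraMap k (MvPolynomial.homogeneousSubmodule (Fin (n + 1)) k 0)))

variable {m : ℕ} (n : Fin m → ℕ)

/-- `ℙ^{n_1} ×_k ⋯ ×_k ℙ^{n_m}`. -/
abbrev multiProjSpace : Scheme.{u} :=
  Limits.widePullback (Spec (CommRingCat.of k)) (fun i => projSpace k (n i))
    (fun i => projSpaceStr k (n i))

/-- The Cox ring `k[x_{i,j} : 1 ≤ i ≤ m, 0 ≤ j ≤ n_i]`; the variable `x_{i,j}` is `X ⟨i, j⟩`. -/
abbrev CoxRing : Type u := MvPolynomial (Σ i : Fin m, Fin (n i + 1)) k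

variable {k n}

/-- Multihomogeneous polynomials (of some multidegree): the variable `x_{i,j}` has degree the
`i`-th standard basis vector of `ℤ^m = Pic (ℙ^{n_1} × ⋯ × ℙ^{n_m})`. -/
def IsMultihomogeneous (f : CoxRing k n) : Prop :=
  ∃ d : Fin m → ℕ, MvPolynomial.IsWeightedHomogeneous
    (fun p : (Σ i : Fin m, Fin (n i + 1)) => (Pi.single p.1 1 : Fin m → ℕ)) f d

variable (k n)

/-- The irrelevant ideal `∏_i (x_{i,0}, …, x_{i,n_i})`. -/
def irrelevantIdeal : Ideal (CoxRing k n) :=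
  ∏ i : Fin m, Ideal.span (Set.range fun j : Fin (n i + 1) =>
    (MvPolynomial.X ⟨i, j⟩ : CoxRing k n))

variable {n}

/-! For `j = (j_1, …, j_m)`, the standard chart `U_j = {x_{1,j_1} ≠ 0, …, x_{m,j_m} ≠ 0}` is the
affine space with coordinates `x_{i,l}`, `l ≠ j_i`, after setting `x_{i,j_i} = 1` for all `i`. -/

/-- The coordinate ring `k[x_{i,l} : l ≠ j_i]` of the standard chart `U_j`. -/
abbrev ChartRing (j : ∀ i, Fin (n i + 1)) : Type u :=
  MvPolynomial {p : (Σ i : Fin m, Fin (n i + 1)) // p.2 ≠ j p.1} k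

/-- Dehomogenization: `x_{i,j_i} ↦ 1` and `x_{i,l} ↦ x_{i,l}` for `l ≠ j_i`. -/
def dehomogenize (j : ∀ i, Fin (n i + 1)) : CoxRing k n →ₐ[k] ChartRing k j :=
  MvPolynomial.aeval fun p => if h : p.2 ≠ j p.1 then MvPolynomial.X ⟨p, h⟩ else 1

/-- Dehomogenization on the homogeneous coordinate ring of the `i`-th factor. -/
def dehomogenizeFactor (j : ∀ i, Fin (n i + 1)) (i : Fin m) :
    MvPolynomial (Fin (n i + 1)) k →ₐ[k] ChartRing k j :=
  (dehomogenize k j).comp (MvPolynomial.rename fun l => ⟨i, l⟩)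

lemma dehomogenizeFactor_X (j : ∀ i, Fin (n i + 1)) (i : Fin m) :
    dehomogenizeFactor k j i (MvPolynomial.X (j i)) = 1 := by
  simp [dehomogenizeFactor, dehomogenize]

/-- The map on coordinate rings `k[x_{i,0}, …, x_{i,n_i}]_{(x_{i,j_i})} → k[x_{i',l} : l ≠ j_{i'}]`
of the `i`-th projection from the standard chart `U_j` to the chart `D_+(x_{i,j_i})` of
`ℙ^{n_i}`. -/
def chartRingMap (j : ∀ i, Fin (n i + 1)) (i : Fin m) :
    HomogeneousLocalization.Away (MvPolynomial.homogeneousSubmodule (Fin (n i + 1)) k)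
      (MvPolynomial.X (j i)) →+* ChartRing k j :=
  (IsLocalization.Away.lift (S := Localization.Away
      (MvPolynomial.X (j i) : MvPolynomial (Fin (n i + 1)) k)) (MvPolynomial.X (j i))
      (g := (dehomogenizeFactor k j i).toRingHom)
      (by
        have h := dehomogenizeFactor_X k j i
        simp only [AlgHom.toRingHom_eq_coe, RingHom.coe_coe, h, isUnit_one])).comp
    (algebraMap (HomogeneousLocalization.Away
      (MvPolynomial.homogeneousSubmodule (Fin (n i + 1)) k) (MvPolynomial.X (j i)))
      (Localization.Away (MvPolynomial.X (j i) : MvPolynomial (Fin (n i + 1)) k)))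

/-- The `i`-th projection `U_j ⟶ ℙ^{n_i}` from the standard chart. -/
def chartProj (j : ∀ i, Fin (n i + 1)) (i : Fin m) :
    Spec (CommRingCat.of (ChartRing k j)) ⟶ projSpace k (n i) :=
  Spec.map (CommRingCat.ofHom (chartRingMap k j i)) ≫
    Proj.awayι (MvPolynomial.homogeneousSubmodule (Fin (n i + 1)) k) (MvPolynomial.X (j i))
      (X_mem_homogeneousSubmodule k (j i)) one_pos

lemma chartProj_projSpaceStr (j : ∀ i, Fin (n i + 1)) (i : Fin m) :
    chartProj k j i ≫ projSpaceStr k (n i) =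
      Spec.map (CommRingCat.ofHom (algebraMap k (ChartRing k j))) := by
  rw [chartProj, projSpaceStr, Category.assoc, Proj.awayι_toSpecZero_assoc, ← Spec.map_comp,
    ← Spec.map_comp]
  congr 1
  rw [← CommRingCat.ofHom_comp, ← CommRingCat.ofHom_comp]
  congr 1
  refine RingHom.ext fun x => ?_
  simp only [RingHom.comp_apply]
  have h : ((HomogeneousLocalization.fromZeroRingHom
      (MvPolynomial.homogeneousSubmodule (Fin (n i + 1)) k)
      (Submonoid.powers (MvPolynomial.X (j i))))
      (algebraMap k (MvPolynomial.homogeneousSubmodule (Fin (n i + 1)) k 0) x)).val =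
      algebraMap (MvPolynomial (Fin (n i + 1)) k) (Localization.Away
        (MvPolynomial.X (j i) : MvPolynomial (Fin (n i + 1)) k))
        (algebraMap k _ x) := by
    rw [← Localization.mk_one_eq_algebraMap]
    rfl
  rw [chartRingMap, RingHom.comp_apply, HomogeneousLocalization.algebraMap_apply, h,
    IsLocalization.Away.lift_eq]
  exact (dehomogenizeFactor k j i).commutes x

/-- The inclusion of the standard chart `U_j` into `ℙ^{n_1} × ⋯ × ℙ^{n_m}`. -/
def chart (j : ∀ i, Fin (n i + 1)) :
    Spec (CommRingCat.of (ChartRing k j)) ⟶ multiProjSpace k n :=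
  Limits.WidePullback.lift (Spec.map (CommRingCat.ofHom (algebraMap k (ChartRing k j))))
    (chartProj k j) (chartProj_projSpaceStr k j)

variable {k}

/-- The ideal sheaf `𝓞(-D_f)` of the hypersurface `D_f` defined by a multihomogeneous
polynomial `f`: the functions whose restriction to each standard chart `U_j` is a multiple of
the dehomogenization of `f`. -/
def hypersurface (f : CoxRing k n) : (multiProjSpace k n).IdealSheafData :=
  ⨅ j : (∀ i, Fin (n i + 1)),
    (Scheme.IdealSheafData.ofIdealTop (Ideal.span
      {(Scheme.ΓSpecIso (CommRingCat.of (ChartRing k j))).inv (dehomogenize k j f)})).map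
        (chart k j)

/-- The ideal in the Cox ring of the closed subscheme with ideal sheaf `X`: it is generated by
the multihomogeneous `f` with `𝓞(-D_f) ⊆ X`. -/
def coxIdeal (X : (multiProjSpace k n).IdealSheafData) : Ideal (CoxRing k n) :=
  Ideal.span {f | IsMultihomogeneous f ∧ hypersurface f ≤ X}

/-- The closed subscheme with ideal sheaf `X` is a strict complete intersection, with respect to
the Cox ring, of the hypersurfaces defined by `f_1, …, f_s`: it is their complete intersection
and its ideal in the Cox ring is generated by `f_1, …, f_s`. -/
def IsStrictCompleteIntersection {s : ℕ} (X : (multiProjSpace k n).IdealSheafData)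
    (f : Fin s → CoxRing k n) : Prop :=
  X.IsCompleteIntersection (fun a => hypersurface (f a)) ∧
    coxIdeal X = Ideal.span (Set.range f)

end MultiProj

end

/-! The key is unmixedness in the Cox ring `R`, a polynomial ring and so Cohen-Macaulay. If every
prime over `I = (f_1, …, f_s)` has height at least `s`, then `I` is generated by a regular sequence
of length `s`, and the associated primes of `R/I` have height at most `s`. An element `r` therefore
lies in `I` as soon as every prime containing `(I : r)` has height greater than `s`
(`HasRegularSequencesOfHeight.mem_span_range_of_forall_lt_height`).

Primes of `R` are of two kinds. A prime containing all chart monomials `x_{1,j_1} ⋯ x_{m,j_m}`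
contains a whole block `x_{i,0}, …, x_{i,n_i}`, so its height exceeds `n_i ≥ s`
(`lt_height_of_forall_X_mem`). A prime `P ⊇ I` missing the monomial of `j` yields a prime of the
chart ring of no larger height containing the dehomogenized `f_a` (`exists_prime_height_le`). The
corresponding closed subset of the chart lies in `X`, so its dimension is at most `∑ n_i - s`, and
`dim A ≤ ht p + dim A/p` gives height at least `s`. Hence `r ∈ I` whenever, for each `j`, some power
of the chart monomial multiplies `r` into `I` (`mem_span_of_isCompleteIntersection`).

Both claims reduce to this criterion. Chart monomials lie in the irrelevant ideal, which gives
saturation. If `𝓞(-D_r) ⊆ 𝓘_X` with `r` multihomogeneous, then on each chart `r` dehomogenizes into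
the ideal of the dehomogenized `f_a` (`dehomogenize_mem_span_of_hypersurface_le`), and clearing
denominators supplies the power. The geometric input is that the charts are an open cover and that
`hypersurface f` restricts on each of them to the ideal of the dehomogenization
(`comap_hypersurface`). -/

noncomputable section

/-! ### Regular sequences, Ext and associated primes. -/

section CommutativeAlgebra

open RingTheory.Sequence Abelian Pointwise

/-- Dimension shifting: if `Ext^i(N, M) = 0` for `i ≤ r` and `g_1, …, g_r` is `M`-regular, then
`Hom(N, M / (g_1, …, g_r) M) = 0`. -/
lemma subsingleton_linearMap_quotient_of_subsingleton_ext {R : Type u} [CommRing R]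
    (N : ModuleCat.{u} R) (gs : List R) (M : ModuleCat.{u} R) (hgs : IsWeaklyRegular M gs)
    (h : ∀ i < gs.length + 1, Subsingleton (Ext N M i)) :
    Subsingleton (N →ₗ[R] (M ⧸ (Ideal.ofList gs • ⊤ : Submodule R M))) := by
  induction gs generalizing M with
  | nil =>
    have h0 := h 0 (by simp)
    have : Subsingleton (N ⟶ M) := Ext.addEquiv₀.subsingleton_congr.mp h0
    have : Subsingleton (N →ₗ[R] M) := ModuleCat.homAddEquiv.symm.subsingleton
    have e : (M ⧸ (Ideal.ofList ([] : List R) • ⊤ : Submodule R M)) ≃ₗ[R] M :=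
      Submodule.quotEquivOfEqBot _ (by simp)
    exact (LinearEquiv.congrRight e).toEquiv.subsingleton
  | cons g gs ih =>
    rw [isWeaklyRegular_cons_iff] at hgs
    have key : Subsingleton (N →ₗ[R] (QuotSMulTop g M ⧸
        (Ideal.ofList gs • ⊤ : Submodule R (QuotSMulTop g M)))) := by
      refine ih (ModuleCat.of R (QuotSMulTop g M)) hgs.2 fun i hi => ?_
      -- In the long exact sequence of `0 → M → M → M/gM → 0`, the group `Ext^i(N, M/gM)` sits
      -- between `Ext^i(N, M)` and `Ext^{i+1}(N, M)`.
      have zero1 := AddCommGrpCat.isZero_of_iff_subsingleton.mpr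
        (h i (by simp only [List.length_cons]; omega))
      have zero2 := AddCommGrpCat.isZero_of_iff_subsingleton.mpr
        (h (i + 1) (by simp only [List.length_cons]; omega))
      exact AddCommGrpCat.subsingleton_of_isZero <| ShortComplex.Exact.isZero_of_both_zeros
        ((Ext.covariant_sequence_exact₃' N hgs.1.smulShortComplex_shortExact) i (i + 1) rfl)
        (zero1.eq_zero_of_src _) (zero2.eq_zero_of_tgt _)
    exact (LinearEquiv.congrRight
      (Submodule.quotOfListConsSMulTopEquivQuotSMulTopInner M g gs)).toEquiv.subsingleton

/-- A prime containing a regular sequence longer than the regular sequence `gs` is not associated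
to `R / (gs)`. -/
lemma not_isAssociatedPrime_of_isWeaklyRegular {R : Type u} [CommRing R] [IsNoetherianRing R]
    {p : Ideal R} [hp : p.IsPrime] {rs gs : List R} (hrs : IsWeaklyRegular R rs)
    (hmem : ∀ r ∈ rs, r ∈ p) (hgs : IsWeaklyRegular R gs) (hlt : gs.length < rs.length) :
    ¬ IsAssociatedPrime p (R ⧸ (Ideal.ofList gs • ⊤ : Submodule R R)) := by
  have hle : Ideal.ofList rs ≤ p := Ideal.span_le.mpr hmem
  have hreg : IsRegular R rs := by
    refine ⟨hrs, fun h => hp.ne_top (top_le_iff.mp ?_)⟩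
    rw [h]
    exact (Submodule.smul_le_right (I := ⊤) (N := Ideal.ofList rs • ⊤)).trans'
      (by simp) |>.trans (by simpa using hle)
  -- Rees: `Ext^i(R/p, R) = 0` for `i` below the length of `rs`. By dimension shifting `Hom(R/p,
  -- R/(gs)) = 0`, whereas an associated prime would embed `R/p` in `R/(gs)`.
  have hext := ModuleCat.subsingleton_ext_of_exists_isRegular p (ModuleCat.of R (R ⧸ p))
    (by rw [Module.support_eq_zeroLocus, Ideal.annihilator_quotient])
    (ModuleCat.of R R) (by
      rw [lt_top_iff_ne_top]
      simpa using hp.ne_top) rs hmem hreg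
  have hsub := subsingleton_linearMap_quotient_of_subsingleton_ext (ModuleCat.of R (R ⧸ p)) gs
    (ModuleCat.of R R) hgs fun i hi => hext i (by omega)
  intro hass
  obtain ⟨_, f, hf⟩ := (_root_.isAssociatedPrime_iff_exists_injective_linearMap _ _).mp hass
  have h0 : f = 0 := hsub.elim _ _
  have h1 : (1 : R ⧸ p) = 0 := hf (by simp [h0])
  exact hp.ne_top ((Ideal.eq_top_iff_one p).mpr (Ideal.Quotient.eq_zero_iff_mem.mp h1))


/-- Every prime contains a regular sequence whose length is the height of the prime (for noetherian
rings this means Cohen-Macaulay). -/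
def HasRegularSequencesOfHeight (R : Type u) [CommRing R] : Prop :=
  ∀ p : Ideal R, p.IsPrime → ∃ rs : List R, IsWeaklyRegular R rs ∧ (∀ r ∈ rs, r ∈ p) ∧
    (rs.length : ℕ∞) = p.height

/-! ### The Cohen-Macaulay property of polynomial rings. -/

section Polynomial

open Polynomial Ideal IsLocalization

-- After localizing at the contraction `p`, any maximal ideal above the extended prime still lies
-- over the maximal ideal of `R_p`, and its height is exactly one more.
attribute [local instance] Polynomial.algebra Polynomial.isLocalization in
lemma Polynomial.height_le_height_comap_C_add_one {R : Type*} [CommRing R] [IsNoetherianRing R]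
    (P : Ideal R[X]) [P.IsPrime] : P.height ≤ (P.comap C).height + 1 := by
  set p := P.comap C with hp
  have : P.LiesOver p := ⟨rfl⟩
  let Rₚ := Localization.AtPrime p
  set p' : Ideal Rₚ := p.map (algebraMap R Rₚ) with p'_def
  have : p'.IsMaximal := by
    rw [p'_def, Localization.AtPrime.map_eq_maximalIdeal]
    exact IsLocalRing.maximalIdeal.isMaximal Rₚ
  let P' : Ideal Rₚ[X] := P.map (algebraMap R[X] Rₚ[X])
  have disj : Disjoint (p.primeCompl.map C : Set R[X]) P := by
    refine Set.disjoint_left.mpr fun a ⟨b, hb⟩ ha ↦ hb.1 ?_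
    rwa [SetLike.mem_coe, LiesOver.over (P := P) (p := p), mem_comap, algebraMap_eq, hb.2]
  have : P'.IsPrime := isPrime_of_isPrime_disjoint _ _ _ ‹_› disj
  have : P'.LiesOver p' := liesOver_of_isPrime_of_disjoint p.primeCompl _ _ disj
  have eq1 : p.height = p'.height := by
    rw [height_map_of_disjoint p.primeCompl]
    exact Disjoint.symm <| Set.disjoint_left.mpr fun _ a b ↦ b a
  have eq2 : P.height = P'.height := by
    rw [height_map_of_disjoint (Submonoid.map C <| p.primeCompl) _ disj]
  obtain ⟨M, hM, hle⟩ := Ideal.exists_le_maximal P' (IsPrime.ne_top ‹_›)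
  have : M.LiesOver p' := by
    refine ⟨(IsMaximal.eq_of_le ‹_› (IsPrime.ne_top inferInstance) ?_)⟩
    rw [LiesOver.over (P := P') (p := p')]
    exact Ideal.comap_mono hle
  rw [eq1, eq2]
  exact (Ideal.height_mono hle).trans (Polynomial.height_eq_height_add_one p' M).le

lemma isSMulRegular_quotient_ofList_iff {R : Type*} [CommRing R] (rs : List R) (r : R) :
    IsSMulRegular (R ⧸ (Ideal.ofList rs • ⊤ : Submodule R R)) r ↔
      ∀ x, r * x ∈ Ideal.ofList rs → x ∈ Ideal.ofList rs := by
  rw [isSMulRegular_iff_right_eq_zero_of_smul]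
  refine (Submodule.Quotient.mk_surjective _).forall.trans (forall_congr' fun x => ?_)
  rw [← Submodule.Quotient.mk_smul, Submodule.Quotient.mk_eq_zero, Submodule.Quotient.mk_eq_zero]
  simp

lemma isWeaklyRegular_concat_iff {R : Type*} [CommRing R] (rs : List R) (r : R) :
    IsWeaklyRegular R (rs ++ [r]) ↔
      IsWeaklyRegular R rs ∧ ∀ x, r * x ∈ Ideal.ofList rs → x ∈ Ideal.ofList rs := by
  rw [isWeaklyRegular_append_iff, isWeaklyRegular_singleton_iff, isSMulRegular_quotient_ofList_iff]

/-- If `rs` is a regular sequence whose length is the height of the prime `p`, then the elements of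
`R / (rs)` killed by `p` form a torsion-free `R / p`-module. -/
lemma HasRegularSequencesOfHeight.mem_ofList_of_mul_mem {R : Type u} [CommRing R]
    [IsNoetherianRing R] (hR : HasRegularSequencesOfHeight R) {p : Ideal R} [hp : p.IsPrime]
    {rs : List R} (hrs : IsWeaklyRegular R rs) (hlen : (rs.length : ℕ∞) = p.height)
    {x r : R} (hx : ∀ a ∈ p, a * x ∈ ofList rs) (hr : r ∉ p) (hrx : r * x ∈ ofList rs) :
    x ∈ ofList rs := by
  by_contra hne
  set M := R ⧸ (ofList rs • ⊤ : Submodule R R)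
  have hmk : ∀ a : R, a * x ∈ ofList rs → a ∈ (⊥ : Submodule R M).colon
      {(Submodule.Quotient.mk x : M)} := by
    intro a ha
    rw [Submodule.mem_colon_singleton, ← Submodule.Quotient.mk_smul, Submodule.mem_bot,
      Submodule.Quotient.mk_eq_zero]
    simpa using ha
  obtain ⟨q, hq, hle⟩ := exists_le_isAssociatedPrime_of_isNoetherianRing R
    (Submodule.Quotient.mk x : M) (by
      rw [ne_eq, Submodule.Quotient.mk_eq_zero]
      simpa using hne)
  have := hq.isPrime
  have hpq : p < q := lt_of_le_of_ne (fun a ha => hle (hmk a (hx a ha)))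
    fun h => hr (h ▸ hle (hmk r hrx))
  -- Since `q` strictly contains `p`, its height, and so the length of `qs`, exceeds the length of
  -- `rs`; such a `q` cannot be associated to `R/(rs)`.
  obtain ⟨qs, hqs, hmem, hqlen⟩ := hR q hq.isPrime
  refine not_isAssociatedPrime_of_isWeaklyRegular hqs hmem hrs ?_ hq
  have h1 := Ideal.height_strict_mono_of_isPrime_of_isPrime hpq
  rw [← hlen, ← hqlen] at h1
  exact_mod_cast h1

/-- A maximal regular sequence of `p = Q ∩ R` stays regular in `R[X]` by flatness. It suffices if `Q
= pR[X]`; otherwise `Q` has height one more than `p`, and one further regular element of `Q` is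
found by showing `Hom(R[X]/Q, R[X]/(rs)) = 0`. -/
lemma HasRegularSequencesOfHeight.polynomial {R : Type u} [CommRing R] [IsNoetherianRing R]
    (hR : HasRegularSequencesOfHeight R) : HasRegularSequencesOfHeight R[X] := by
  intro Q hQ
  set p := Q.comap C with hp
  have hover : Q.LiesOver p := ⟨rfl⟩
  have hpp : p.IsPrime := inferInstance
  obtain ⟨rs, hrs, hmem, hlen⟩ := hR p hpp
  have hrs' : IsWeaklyRegular R[X] (rs.map C) := IsWeaklyRegular.of_flat (S := R[X]) hrs
  have hmem' : ∀ r ∈ rs.map C, r ∈ Q := by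
    intro r hr
    obtain ⟨a, ha, rfl⟩ := List.mem_map.mp hr
    exact hmem a ha
  have hpQ : p.map C ≤ Q := Ideal.map_comap_le
  have hof : ofList (rs.map C) = (ofList rs).map C := (Ideal.map_ofList C rs).symm
  have hheight := Ideal.height_eq_height_add_of_liesOver_of_hasGoingDown p Q
  by_cases hQp : Q = p.map C
  · refine ⟨rs.map C, hrs', hmem', ?_⟩
    have : Q.map (Ideal.Quotient.mk (p.map (algebraMap R R[X]))) = ⊥ := by
      rw [Ideal.map_eq_bot_iff_le_ker, Ideal.mk_ker]
      exact hQp.le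
    have : Nontrivial (R[X] ⧸ p.map (algebraMap R R[X])) :=
      Ideal.Quotient.nontrivial_iff.mpr fun h => hQ.ne_top (hQp.trans h)
    rw [hheight, ‹Q.map _ = ⊥›, Ideal.height_bot, add_zero, List.length_map, hlen]
  · obtain ⟨f, hfQ, hfp⟩ := SetLike.exists_of_lt (lt_of_le_of_ne hpQ (Ne.symm hQp))
    have key : ∀ h : R[X], (∀ g ∈ Q, g * h ∈ ofList (rs.map C)) → h ∈ ofList (rs.map C) := by
      classical
      intro h hh
      by_contra hcon
      rw [hof, mem_map_C_iff] at hcon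
      rw [mem_map_C_iff] at hfp
      push Not at hcon hfp
      have hmax : ∀ (F : R[X]) (J : Ideal R), (∃ u, F.coeff u ∉ J) →
          ∃ u, F.coeff u ∉ J ∧ ∀ v, u < v → F.coeff v ∈ J := by
        rintro F J ⟨u, hu⟩
        have hbdd : ∀ v, F.coeff v ∉ J → v ≤ F.natDegree := fun v hv => by
          by_contra hlt
          exact hv (by rw [coeff_eq_zero_of_natDegree_lt (not_le.mp hlt)]; exact J.zero_mem)
        refine ⟨Nat.findGreatest (fun v => F.coeff v ∉ J) F.natDegree,
          Nat.findGreatest_spec (P := fun v => F.coeff v ∉ J) (hbdd u hu) hu, fun v hv => ?_⟩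
        by_contra hvJ
        exact Nat.findGreatest_is_greatest hv (hbdd v hvJ) hvJ
      -- Take the top coefficient `f_u` outside `p` and the top coefficient `h_v` outside `(rs)`. In
      -- degree `u + v` of `f * h` every other term lies in `(rs)`: below `u` because of the
      -- coefficient of `h`, above `u` because `p` kills the coefficients of `h` modulo `(rs)`. So
      -- `f_u h_v ∈ (rs)`, which forces `h_v ∈ (rs)`.
      obtain ⟨u, hu, hu'⟩ := hmax f p hfp
      obtain ⟨v, hv, hv'⟩ := hmax h (ofList rs) hcon
      have hann : ∀ w, ∀ a ∈ p, a * h.coeff w ∈ ofList rs := by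
        intro w a ha
        have := hh (C a) ha
        rw [hof, mem_map_C_iff] at this
        simpa using this w
      refine hv (hR.mem_ofList_of_mul_mem hrs hlen (hann v) hu ?_)
      have hfh := hh f hfQ
      rw [hof, mem_map_C_iff] at hfh
      have hfh := hfh (u + v)
      rw [coeff_mul, ← Finset.add_sum_erase _ _
        (show (u, v) ∈ Finset.HasAntidiagonal.antidiagonal (u + v) by simp)] at hfh
      refine ((ofList rs).add_mem_iff_left (Ideal.sum_mem _ fun x hx => ?_)).mp hfh
      obtain ⟨hne, hx⟩ := Finset.mem_erase.mp hx
      rw [Finset.HasAntidiagonal.mem_antidiagonal] at hx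
      rcases lt_trichotomy x.1 u with h1 | h1 | h1
      · exact Ideal.mul_mem_left _ _ (hv' _ (by omega))
      · exact absurd (Prod.ext h1 (by simp only; omega)) hne
      · exact hann _ _ (hu' _ h1)
    set M := R[X] ⧸ (ofList (rs.map C) • ⊤ : Submodule R[X] R[X])
    have hsub : Subsingleton ((R[X] ⧸ Q) →ₗ[R[X]] M) := by
      refine subsingleton_of_forall_eq 0 fun φ => ?_
      obtain ⟨h, hh⟩ := Submodule.Quotient.mk_surjective _ (φ 1)
      have hmem : h ∈ ofList (rs.map C) := by
        refine key h fun g hg => ?_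
        have h0 : g • φ 1 = 0 := by
          rw [← map_smul, Algebra.smul_def, mul_one]
          simp [Ideal.Quotient.algebraMap_eq, Ideal.Quotient.eq_zero_iff_mem.mpr hg]
        rw [← hh, ← Submodule.Quotient.mk_smul, Submodule.Quotient.mk_eq_zero] at h0
        simpa using h0
      have h1 : φ 1 = 0 := by
        rw [← hh, Submodule.Quotient.mk_eq_zero]
        simpa using hmem
      ext
      simpa using h1
    -- Vanishing of this Hom means that the annihilator `Q` contains an element regular on
    -- `R[X]/(rs)`.
    obtain ⟨g, hg, hreg⟩ := IsSMulRegular.subsingleton_linearMap_iff.mp hsub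
    rw [Ideal.annihilator_quotient] at hg
    refine ⟨rs.map C ++ [g], (isWeaklyRegular_concat_iff _ _).mpr
      ⟨hrs', (isSMulRegular_quotient_ofList_iff _ _).mp hreg⟩, ?_, ?_⟩
    · intro r hr
      rcases List.mem_append.mp hr with hr | hr
      · exact hmem' r hr
      · rwa [List.mem_singleton.mp hr]
    · rw [List.length_append, List.length_map, List.length_singleton, Nat.cast_add, hlen,
        Nat.cast_one]
      refine le_antisymm ?_ (height_le_height_comap_C_add_one Q)
      have hdom : IsDomain (R[X] ⧸ p.map (algebraMap R R[X])) := by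
        have : (p.map (algebraMap R R[X])).IsPrime := isPrime_map_C_of_isPrime (P := p)
        infer_instance
      have hker : RingHom.ker (Ideal.Quotient.mk (p.map (algebraMap R R[X]))) ≤ Q := by
        rw [Ideal.mk_ker]; exact hpQ
      have := Ideal.map_isPrime_of_surjective Ideal.Quotient.mk_surjective hker
      rw [hheight]
      gcongr
      rw [Order.one_le_iff_ne_zero, ne_eq, Ideal.height_eq_zero_iff_eq_bot,
        Ideal.map_eq_bot_iff_le_ker, Ideal.mk_ker]
      exact fun h => hQp (le_antisymm h hpQ)

end Polynomial

lemma HasRegularSequencesOfHeight.of_ringEquiv {R S : Type u} [CommRing R] [CommRing S]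
    (hR : HasRegularSequencesOfHeight R) (e : R ≃+* S) : HasRegularSequencesOfHeight S := by
  intro p hp
  obtain ⟨rs, hrs, hmem, hlen⟩ := hR (p.comap e) inferInstance
  refine ⟨rs.map e, ?_, ?_, ?_⟩
  · refine (AddEquiv.isWeaklyRegular_congr (e := e.toAddEquiv) ?_).mp hrs
    refine List.forall₂_map_right_iff.mpr (List.forall₂_same.mpr fun r _ x => ?_)
    simp
  · intro r hr
    obtain ⟨a, ha, rfl⟩ := List.mem_map.mp hr
    exact hmem a ha
  · rw [List.length_map, hlen, RingEquiv.height_comap]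

lemma MvPolynomial.hasRegularSequencesOfHeight (k : Type u) [Field k] (σ : Type) [Finite σ] :
    HasRegularSequencesOfHeight (MvPolynomial σ k) := by
  induction σ using Finite.induction_empty_option with
  | of_equiv e H => exact H.of_ringEquiv (renameEquiv _ e).toRingEquiv
  | h_empty =>
    refine HasRegularSequencesOfHeight.of_ringEquiv (R := k) (fun p hp => ⟨[], by simp, by simp, ?_⟩)
      (isEmptyRingEquiv k _).symm
    rw [(Ideal.eq_bot_or_top p).resolve_right hp.ne_top, Ideal.height_bot]
    simp
  | h_option IH => exact IH.polynomial.of_ringEquiv (optionEquivLeft _ _).toRingEquiv.symm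


/-! ### Prime avoidance and unmixedness. -/

/-- Prime avoidance for cosets: if no prime of a finite set contains both `x` and `J`, some
element of `x + J` lies in none of them. -/
lemma Ideal.exists_add_notMem_of_finite {R : Type*} [CommRing R] (x : R) (J : Ideal R)
    (S : Finset (Ideal R)) (hS : ∀ P ∈ S, P.IsPrime) (h : ∀ P ∈ S, x ∈ P → ¬ J ≤ P) :
    ∃ y ∈ J, ∀ P ∈ S, x + y ∉ P := by
  classical
  induction S using Finset.strongInduction with
  | H S ih =>
    rcases S.eq_empty_or_nonempty with rfl | hne
    · exact ⟨0, J.zero_mem, by simp⟩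
    obtain ⟨P, hPS, hmin⟩ := S.exists_minimal hne
    have hP := hS P hPS
    obtain ⟨y, hy, hyS⟩ := ih (S.erase P) (Finset.erase_ssubset hPS)
      (fun Q hQ => hS Q (Finset.mem_of_mem_erase hQ)) fun Q hQ => h Q (Finset.mem_of_mem_erase hQ)
    by_cases hxy : x + y ∈ P
    · have hJP : ¬ J ≤ P := fun hle => h P hPS ((P.add_mem_iff_left (hle hy)).mp hxy) hle
      -- Correct `y` by an element of `J` lying in all the other primes but not in `P`; it exists
      -- because `P` is minimal in `S`, so no other member is contained in it.
      have hinf : ¬ J ⊓ (S.erase P).inf id ≤ P := by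
        rw [hP.inf_le, hP.inf_le']
        rintro (hle | ⟨Q, hQ, hle⟩)
        · exact hJP hle
        · have hQ' := Finset.mem_erase.mp hQ
          exact hQ'.1 (le_antisymm hle (hmin hQ'.2 hle))
      obtain ⟨z, hz, hzP⟩ := SetLike.not_le_iff_exists.mp hinf
      refine ⟨y + z, J.add_mem hy hz.1, fun Q hQ => ?_⟩
      rw [← add_assoc]
      by_cases hQP : Q = P
      · subst hQP
        rwa [Ideal.add_mem_iff_right _ hxy]
      · have hQ' := Finset.mem_erase.mpr ⟨hQP, hQ⟩
        have : z ∈ Q := Finset.inf_le (f := id) hQ' hz.2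
        rw [Q.add_mem_iff_left this]
        exact hyS Q hQ'
    · refine ⟨y, hy, fun Q hQ => ?_⟩
      by_cases hQP : Q = P
      · rwa [hQP]
      · exact hyS Q (Finset.mem_erase.mpr ⟨hQP, hQ⟩)

/-- The associated primes of a regular sequence of length `t` have height at most `t`. -/
lemma HasRegularSequencesOfHeight.height_le_of_isAssociatedPrime {R : Type u} [CommRing R]
    [IsNoetherianRing R] (hR : HasRegularSequencesOfHeight R) {gs : List R}
    (hgs : IsWeaklyRegular R gs) {P : Ideal R}
    (hP : IsAssociatedPrime P (R ⧸ (Ideal.ofList gs • ⊤ : Submodule R R))) :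
    P.height ≤ gs.length := by
  have := hP.isPrime
  obtain ⟨rs, hrs, hmem, hlen⟩ := hR P hP.isPrime
  by_contra! hlt
  refine not_isAssociatedPrime_of_isWeaklyRegular hrs hmem hgs ?_ hP
  rw [← hlen] at hlt
  exact_mod_cast hlt

/-- An ideal of height at least `s` generated by `s` elements is generated by a regular sequence of
length `s`. -/
lemma HasRegularSequencesOfHeight.exists_isWeaklyRegular_ofList_eq {R : Type u} [CommRing R]
    [IsNoetherianRing R] (hR : HasRegularSequencesOfHeight R) {s : ℕ} (f : Fin s → R)
    (hf : ∀ P : Ideal R, P.IsPrime → Ideal.span (Set.range f) ≤ P → (s : ℕ∞) ≤ P.height) :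
    ∃ gs : List R, gs.length = s ∧ IsWeaklyRegular R gs ∧
      Ideal.ofList gs = Ideal.span (Set.range f) := by
  -- The generators are replaced one at a time: `t` regular elements together with the `f a`, `a ≥
  -- t`, still generate the ideal.
  suffices H : ∀ t ≤ s, ∃ gs : List R, gs.length = t ∧ IsWeaklyRegular R gs ∧
      Ideal.ofList gs ⊔ Ideal.span (f '' {a | t ≤ a.val}) = Ideal.span (Set.range f) by
    obtain ⟨gs, hlen, hreg, heq⟩ := H s le_rfl
    refine ⟨gs, hlen, hreg, ?_⟩
    have : {a : Fin s | s ≤ a.val} = ∅ := by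
      ext a
      simp
    rwa [this, Set.image_empty, Ideal.span_empty, sup_bot_eq] at heq
  intro t
  induction t with
  | zero => exact fun _ => ⟨[], rfl, by simp, by simp⟩
  | succ t ih =>
    intro hts
    obtain ⟨gs, hlen, hreg, heq⟩ := ih (by omega)
    set J := Ideal.span (f '' {a | t + 1 ≤ a.val}) with hJ
    set x := f ⟨t, hts⟩ with hx
    have hsplit : Ideal.span (f '' {a | t ≤ a.val}) = Ideal.span {x} ⊔ J := by
      rw [hJ, ← Ideal.span_union]
      congr 1
      have : {a : Fin s | t ≤ a.val} = {⟨t, hts⟩} ∪ {a | t + 1 ≤ a.val} := by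
        ext a
        simp only [Set.mem_ofPred_eq, Set.mem_union, Set.mem_singleton_iff, Fin.ext_iff]
        omega
      rw [this, Set.image_union, Set.image_singleton]
    rw [hsplit] at heq
    have hfin := associatedPrimes.finite R (R ⧸ (Ideal.ofList gs • ⊤ : Submodule R R))
    have hgsP : ∀ P ∈ associatedPrimes R (R ⧸ (Ideal.ofList gs • ⊤ : Submodule R R)),
        Ideal.ofList gs ≤ P := by
      intro P hP
      refine le_trans ?_ (IsAssociatedPrime.annihilator_le hP)
      rw [Submodule.annihilator_top, smul_eq_mul, Ideal.mul_top, Ideal.annihilator_quotient]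
    -- An associated prime of `R/(gs)` containing both `x` and `J` would contain the whole ideal, so
    -- have height at least `s`; but its height is at most `t < s`.
    obtain ⟨y, hy, hyP⟩ := Ideal.exists_add_notMem_of_finite x J hfin.toFinset
      (fun P hP => ((hfin.mem_toFinset).mp hP).isPrime) (fun P hP hxP hJP => by
        rw [hfin.mem_toFinset] at hP
        have h1 := hf P hP.isPrime (by
          rw [← heq, sup_le_iff, sup_le_iff, Ideal.span_singleton_le_iff_mem]
          exact ⟨hgsP P hP, hxP, hJP⟩)
        have h2 := h1.trans (hR.height_le_of_isAssociatedPrime hreg hP)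
        rw [hlen] at h2
        have h3 : s ≤ t := by exact_mod_cast h2
        omega)
    refine ⟨gs ++ [x + y], by simp [hlen], ?_, ?_⟩
    · rw [isWeaklyRegular_append_iff, isWeaklyRegular_singleton_iff]
      refine ⟨hreg, ?_⟩
      by_contra hcon
      have : x + y ∈ (⋃ P ∈ associatedPrimes R (R ⧸ (Ideal.ofList gs • ⊤ : Submodule R R)),
          (P : Set R)) := by
        rw [biUnion_associatedPrimes_eq_compl_regular]
        exact hcon
      obtain ⟨P, hP, hmem⟩ := Set.mem_iUnion₂.mp this
      exact hyP P (hfin.mem_toFinset.mpr hP) hmem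
    · rw [Ideal.ofList_append, Ideal.ofList_singleton, ← heq, sup_assoc]
      congr 1
      refine le_antisymm (sup_le ?_ le_sup_right) (sup_le ?_ le_sup_right)
      · rw [Ideal.span_singleton_le_iff_mem]
        exact add_mem (Ideal.mem_sup_left (Ideal.mem_span_singleton_self x))
          (Ideal.mem_sup_right hy)
      · rw [Ideal.span_singleton_le_iff_mem]
        have := sub_mem (Ideal.mem_sup_left (Ideal.mem_span_singleton_self (x + y)))
          (Ideal.mem_sup_right (S := Ideal.span {x + y}) hy)
        rwa [add_sub_cancel_right] at this

/-- Unmixedness: if `I` is generated by `s` elements, all primes containing `I` have height at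
least `s`, and every prime containing `{y | y r ∈ I}` has height greater than `s`, then `r ∈ I`. -/
lemma HasRegularSequencesOfHeight.mem_span_range_of_forall_lt_height {R : Type u} [CommRing R]
    [IsNoetherianRing R] (hR : HasRegularSequencesOfHeight R) {s : ℕ} (f : Fin s → R)
    (hf : ∀ P : Ideal R, P.IsPrime → Ideal.span (Set.range f) ≤ P → (s : ℕ∞) ≤ P.height) {r : R}
    (hr : ∀ P : Ideal R, P.IsPrime → (∀ y, y * r ∈ Ideal.span (Set.range f) → y ∈ P) →
      (s : ℕ∞) < P.height) : r ∈ Ideal.span (Set.range f) := by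
  obtain ⟨gs, hlen, hreg, heq⟩ := hR.exists_isWeaklyRegular_ofList_eq f hf
  rw [← heq] at hr ⊢
  by_contra hne
  obtain ⟨q, hq, hle⟩ := exists_le_isAssociatedPrime_of_isNoetherianRing R
    (Submodule.Quotient.mk r : R ⧸ (Ideal.ofList gs • ⊤ : Submodule R R)) (by
      rw [ne_eq, Submodule.Quotient.mk_eq_zero]
      simpa using hne)
  refine (hR.height_le_of_isAssociatedPrime hreg hq).not_gt (hlen ▸ hr q hq.isPrime fun y hy => ?_)
  apply hle
  rw [Submodule.mem_colon_singleton, ← Submodule.Quotient.mk_smul, Submodule.mem_bot,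
    Submodule.Quotient.mk_eq_zero]
  simpa using hy

end CommutativeAlgebra

/-! ### Heights and dimensions in polynomial rings over a field. -/

section Dimension

/-- Passing from `A` to `A[X]`, the sum of the height of a prime and the transcendence degree of its
residue ring grows by at least one. -/
lemma Polynomial.exists_le_height_add_trdeg {k A : Type u} [Field k] [CommRing A] [Algebra k A]
    [IsNoetherianRing A] {d : ℕ}
    (hA : ∀ p : Ideal A, p.IsPrime → ∃ r : ℕ, (d : ℕ∞) ≤ p.height + r ∧
      (r : Cardinal) ≤ Algebra.trdeg k (A ⧸ p))
    (Q : Ideal (Polynomial A)) [hQ : Q.IsPrime] :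
    ∃ r : ℕ, ((d + 1 : ℕ) : ℕ∞) ≤ Q.height + r ∧
      (r : Cardinal) ≤ Algebra.trdeg k (Polynomial A ⧸ Q) := by
  set p := Q.comap Polynomial.C with hp
  have hover : Q.LiesOver p := ⟨rfl⟩
  have hpp : p.IsPrime := inferInstance
  obtain ⟨r, hd, hr⟩ := hA p hpp
  have hpQ : p.map Polynomial.C ≤ Q := Ideal.map_comap_le
  have hheight := Ideal.height_eq_height_add_of_liesOver_of_hasGoingDown p Q
  -- If `Q = pA[X]` the residue ring is `(A/p)[X]` and the transcendence degree grows; otherwise the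
  -- height grows.
  by_cases hQp : Q = p.map Polynomial.C
  · refine ⟨r + 1, ?_, ?_⟩
    · push_cast
      rw [← add_assoc]
      gcongr
      exact hd.trans (by gcongr; rw [hheight]; exact le_self_add)
    · let φ : Polynomial (A ⧸ p) →ₐ[k] (Polynomial A ⧸ p.map Polynomial.C) :=
        { (Ideal.polynomialQuotientEquivQuotientPolynomial p).toRingHom with
          commutes' := fun c => by
            simp only [Polynomial.algebraMap_apply]
            simp [Ideal.polynomialQuotientEquivQuotientPolynomial]
            rfl }
      have h1 := trdeg_le_of_injective φ
        (Ideal.polynomialQuotientEquivQuotientPolynomial p).injective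
      have h2 := trdeg_add_le (R := k) (S := A ⧸ p) (A := Polynomial (A ⧸ p))
      rw [Polynomial.trdeg_of_isDomain] at h2
      rw [hQp]
      refine le_trans ?_ (h2.trans h1)
      push_cast
      gcongr
  · refine ⟨r, ?_, ?_⟩
    · have hdom : IsDomain (Polynomial A ⧸ p.map (algebraMap A (Polynomial A))) := by
        have : (p.map (algebraMap A (Polynomial A))).IsPrime := Ideal.isPrime_map_C_of_isPrime (P := p)
        infer_instance
      have hker : RingHom.ker (Ideal.Quotient.mk (p.map (algebraMap A (Polynomial A)))) ≤ Q := by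
        rw [Ideal.mk_ker]; exact hpQ
      have := Ideal.map_isPrime_of_surjective Ideal.Quotient.mk_surjective hker
      have h1 : p.height + 1 ≤ Q.height := by
        rw [hheight]
        gcongr
        rw [Order.one_le_iff_ne_zero, ne_eq, Ideal.height_eq_zero_iff_eq_bot,
          Ideal.map_eq_bot_iff_le_ker, Ideal.mk_ker]
        exact fun h => hQp (le_antisymm h hpQ)
      calc ((d + 1 : ℕ) : ℕ∞) = d + 1 := by push_cast; rfl
        _ ≤ p.height + r + 1 := by gcongr
        _ = p.height + 1 + r := by ring
        _ ≤ Q.height + r := by gcongr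
    · exact hr.trans (trdeg_le_of_injective
        (Ideal.quotientMapₐ Q (Polynomial.CAlgHom (R := k) (A := A)) le_rfl)
        Ideal.quotientMap_injective)

lemma exists_le_height_add_trdeg_of_algEquiv {k A B : Type u} [Field k] [CommRing A] [CommRing B]
    [Algebra k A] [Algebra k B] {d : ℕ}
    (h : ∀ p : Ideal A, p.IsPrime → ∃ r : ℕ, (d : ℕ∞) ≤ p.height + r ∧
      (r : Cardinal) ≤ Algebra.trdeg k (A ⧸ p)) (e : A ≃ₐ[k] B) (p : Ideal B) [hp : p.IsPrime] :
    ∃ r : ℕ, (d : ℕ∞) ≤ p.height + r ∧ (r : Cardinal) ≤ Algebra.trdeg k (B ⧸ p) := by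
  have hprime : (p.comap e.toRingEquiv).IsPrime := inferInstance
  obtain ⟨r, hd, hr⟩ := h (p.comap e.toRingEquiv) hprime
  rw [RingEquiv.height_comap] at hd
  let φ : (A ⧸ p.comap e.toRingEquiv) →ₐ[k] B ⧸ p := Ideal.quotientMapₐ p e.toAlgHom (fun _ h => h)
  have hφ : Function.Injective φ :=
    Ideal.quotientMap_injective (I := p) (f := (e.toAlgHom : A →+* B))
  exact ⟨r, hd, hr.trans (trdeg_le_of_injective φ hφ)⟩

/-- Heights are extended naturals and transcendence degrees are cardinals, so the inequality between
them passes through a natural number `r`. -/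
lemma MvPolynomial.exists_le_height_add_trdeg (k : Type u) [Field k] (σ : Type) [Finite σ]
    (p : Ideal (MvPolynomial σ k)) (hp : p.IsPrime) :
    ∃ r : ℕ, (Nat.card σ : ℕ∞) ≤ p.height + r ∧
      (r : Cardinal) ≤ Algebra.trdeg k (MvPolynomial σ k ⧸ p) := by
  induction σ using Finite.induction_empty_option with
  | of_equiv e H =>
    rw [← Nat.card_congr e]
    exact exists_le_height_add_trdeg_of_algEquiv H (renameEquiv k e) p
  | h_empty => exact ⟨0, by simp⟩
  | @h_option τ _ IH =>
    have : Nat.card (Option τ) = Nat.card τ + 1 := by simp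
    rw [this]
    exact exists_le_height_add_trdeg_of_algEquiv
      (fun q hq => Polynomial.exists_le_height_add_trdeg IH q) (optionEquivLeft k τ).symm p

lemma ringKrullDim_le_of_isIntegral {A B : Type*} [CommRing A] [CommRing B] [IsDomain A] [IsDomain B]
    [Algebra A B] [Algebra.IsIntegral A B] (h : Function.Injective (algebraMap A B)) {n : ℕ}
    (hn : (n : WithBot ℕ∞) ≤ ringKrullDim A) : (n : WithBot ℕ∞) ≤ ringKrullDim B := by
  obtain ⟨l, hl⟩ := Order.le_krullDim_iff.mp hn
  obtain ⟨P, hP, hPl⟩ := Ideal.exists_ideal_over_prime_of_isIntegral_of_isDomain (S := B)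
    l.head.asIdeal (by rw [(RingHom.injective_iff_ker_eq_bot _).mp h]; exact bot_le)
  have : P.LiesOver l.head.asIdeal := ⟨hPl.symm⟩
  obtain ⟨L, hL, -⟩ := Ideal.exists_ltSeries_of_hasGoingUp l P
  exact Order.le_krullDim_iff.mpr ⟨L, hL.trans hl⟩

/-- By Noether normalization `B` is integral over a polynomial ring whose number of variables is the
transcendence degree, and chains of primes lift along this extension. -/
lemma natCast_le_ringKrullDim_of_le_trdeg {k B : Type u} [Field k] [CommRing B] [IsDomain B]
    [Algebra k B] [Algebra.FiniteType k B] {r : ℕ} (hr : (r : Cardinal) ≤ Algebra.trdeg k B) :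
    (r : WithBot ℕ∞) ≤ ringKrullDim B := by
  obtain ⟨s, g, hg, hint⟩ := exists_integral_inj_algHom_of_fg k B
  algebraize [g.toRingHom]
  have hinj : Function.Injective (algebraMap (MvPolynomial (Fin s) k) B) := hg
  have : FaithfulSMul (MvPolynomial (Fin s) k) B := (faithfulSMul_iff_algebraMap_injective _ _).mpr hinj
  have : IsScalarTower k (MvPolynomial (Fin s) k) B := IsScalarTower.of_algebraMap_eq' (by
    ext x; exact (g.commutes x).symm)
  have : Algebra.IsIntegral (MvPolynomial (Fin s) k) B := ⟨hint⟩
  have h1 := trdeg_add_eq (R := k) (S := MvPolynomial (Fin s) k) (A := B)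
  rw [trdeg_eq_zero (R := MvPolynomial (Fin s) k), add_zero,
    MvPolynomial.trdeg_of_isDomain] at h1
  rw [← h1] at hr
  have hrs : r ≤ s := by simpa using hr
  have hs := ringKrullDim_le_of_isIntegral hinj (n := s) (by simp)
  exact le_trans (by exact_mod_cast hrs) hs

/-- In a polynomial ring over a field, `dim A ≤ ht p + dim A / p`. -/
lemma MvPolynomial.card_le_height_add_ringKrullDim (k : Type u) [Field k] (σ : Type) [Finite σ]
    (p : Ideal (MvPolynomial σ k)) [hp : p.IsPrime] :
    ((Nat.card σ : ℕ∞) : WithBot ℕ∞) ≤ p.height + ringKrullDim (MvPolynomial σ k ⧸ p) := by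
  obtain ⟨r, h1, h2⟩ := MvPolynomial.exists_le_height_add_trdeg k σ p hp
  have h3 := natCast_le_ringKrullDim_of_le_trdeg (k := k) h2
  calc ((Nat.card σ : ℕ∞) : WithBot ℕ∞) ≤ ((p.height + r : ℕ∞) : WithBot ℕ∞) :=
        WithBot.coe_le_coe.mpr h1
    _ = p.height + (r : WithBot ℕ∞) := by push_cast; rfl
    _ ≤ _ := by gcongr

lemma Ideal.height_under_le_of_flat (A : Type*) {B : Type*} [CommRing A] [CommRing B]
    [IsNoetherianRing A] [IsNoetherianRing B] [Algebra A B] [Module.Flat A B]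
    (P : Ideal B) [P.IsPrime] : (P.under A).height ≤ P.height := by
  rw [Ideal.height_eq_height_add_of_liesOver_of_hasGoingDown (P.under A) P]
  exact le_self_add

/-- Contracting a prime to a polynomial subring in fewer variables does not increase the height. -/
lemma MvPolynomial.height_comap_rename_subtypeVal_le {k : Type*} [Field k] {σ : Type*} [Finite σ]
    (q : σ → Prop) (P : Ideal (MvPolynomial σ k)) [hP : P.IsPrime] :
    (P.comap (rename (Subtype.val : Subtype q → σ) : MvPolynomial (Subtype q) k →ₐ[k] _)).height ≤
      P.height := by
  classical
  -- The big ring is a polynomial ring over the small one, hence flat, and going down applies.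
  let e : MvPolynomial {a // ¬ q a} (MvPolynomial (Subtype q) k) ≃ₐ[k] MvPolynomial σ k :=
    (sumAlgEquiv k {a // ¬ q a} (Subtype q)).symm.trans
      (renameEquiv k ((Equiv.sumComm _ _).trans (Equiv.sumCompl q)))
  let P' := P.comap e.toRingEquiv
  have hP' : P'.IsPrime := inferInstance
  have hcomap : P.comap (rename (Subtype.val : Subtype q → σ) : MvPolynomial (Subtype q) k →ₐ[k] _) =
      P'.under (MvPolynomial (Subtype q) k) := by
    have : ∀ x, e (C x) = rename (Subtype.val : Subtype q → σ) x := by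
      intro x
      have h : (sumAlgEquiv k {a // ¬ q a} (Subtype q)).symm (C x) = rename Sum.inr x :=
        (AlgEquiv.symm_apply_eq _).mpr (DFunLike.congr_fun (sumAlgEquiv_comp_rename_inr k _ _) x).symm
      simp only [e, AlgEquiv.trans_apply, h, renameEquiv_apply, rename_rename]
      rfl
    ext x
    rw [Ideal.mem_comap, ← this]
    rfl
  rw [hcomap, ← RingEquiv.height_comap e.toRingEquiv P]
  exact Ideal.height_under_le_of_flat _ P'

end Dimension

/-! ### The Cox ring, its localizations at chart monomials, and heights of its primes. -/

namespace MultiProj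

variable {k : Type u} [Field k] {m : ℕ} {n : Fin m → ℕ}

/-- Rescaling the `i`-th block of variables by `u i` multiplies a polynomial of multidegree `d` by
`∏ i, u i ^ d i`. -/
lemma aeval_mul_of_isWeightedHomogeneous {C : Type*} [CommRing C] [Algebra k C]
    {f : CoxRing k n} {d : Fin m → ℕ}
    (hf : MvPolynomial.IsWeightedHomogeneous
      (fun p : (Σ i : Fin m, Fin (n i + 1)) => (Pi.single p.1 1 : Fin m → ℕ)) f d)
    (u : Fin m → C) (v : (Σ i : Fin m, Fin (n i + 1)) → C) :
    MvPolynomial.aeval (fun p => u p.1 * v p) f = (∏ i, u i ^ d i) * MvPolynomial.aeval v f := by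
  rw [MvPolynomial.aeval_def, MvPolynomial.aeval_def, MvPolynomial.eval₂_eq',
    MvPolynomial.eval₂_eq', Finset.mul_sum]
  refine Finset.sum_congr rfl fun e he => ?_
  have hd := hf (MvPolynomial.mem_support_iff.mp he)
  have hprod : ∏ i, u i ^ d i = ∏ p, u (Sigma.fst p) ^ e p := by
    have h1 : ∀ i, d i = ∑ p, e p * (Pi.single (Sigma.fst p) 1 : Fin m → ℕ) i := by
      intro i
      rw [← hd, Finsupp.weight_apply, Finsupp.sum_fintype _ _ (by simp)]
      simp
    simp_rw [h1, ← Finset.prod_pow_eq_pow_sum]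
    rw [Finset.prod_comm]
    refine Finset.prod_congr rfl fun p _ => ?_
    rw [Finset.prod_eq_single p.1]
    · simp
    · intro i _ hi
      simp [Pi.single_eq_of_ne hi]
    · simp
  simp_rw [mul_pow, Finset.prod_mul_distrib, hprod]
  ring

/-- The product `x_{1,j_1} ⋯ x_{m,j_m}` which is invertible on the chart `U_j`. -/
def chartMonomial (k : Type u) [Field k] (j : ∀ i, Fin (n i + 1)) : CoxRing k n :=
  ∏ i, MvPolynomial.X ⟨i, j i⟩

section Localization

variable (j : ∀ i, Fin (n i + 1))

/-- The localization of the Cox ring at the chart monomial. -/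
abbrev CoxLocalization (k : Type u) [Field k] (j : ∀ i, Fin (n i + 1)) : Type u :=
  Localization.Away (chartMonomial k j)

/-- The localization map of the Cox ring. -/
def toCoxLocalization (k : Type u) [Field k] (j : ∀ i, Fin (n i + 1)) :
    CoxRing k n →ₐ[k] CoxLocalization k j :=
  IsScalarTower.toAlgHom k (CoxRing k n) (CoxLocalization k j)

lemma toCoxLocalization_apply (f : CoxRing k n) :
    toCoxLocalization k j f = algebraMap (CoxRing k n) (CoxLocalization k j) f := rfl

lemma isUnit_toCoxLocalization_chartMonomial :
    IsUnit (toCoxLocalization k j (chartMonomial k j)) :=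
  IsLocalization.Away.algebraMap_isUnit (chartMonomial k j)

lemma isUnit_toCoxLocalization_X (i : Fin m) :
    IsUnit (toCoxLocalization k j (MvPolynomial.X ⟨i, j i⟩)) :=
  have h : MvPolynomial.X ⟨i, j i⟩ ∣ chartMonomial k j :=
    Finset.dvd_prod_of_mem (fun i => (MvPolynomial.X ⟨i, j i⟩ : CoxRing k n)) (Finset.mem_univ i)
  isUnit_of_dvd_unit (map_dvd _ h) (isUnit_toCoxLocalization_chartMonomial j)

/-- The invertible element `x_{i,j_i}` of the localization of the Cox ring. -/
def chartUnit (k : Type u) [Field k] (j : ∀ i, Fin (n i + 1)) (i : Fin m) :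
    (CoxLocalization k j)ˣ :=
  (isUnit_toCoxLocalization_X j i).unit

lemma coe_chartUnit (i : Fin m) : (chartUnit k j i : CoxLocalization k j) =
    toCoxLocalization k j (MvPolynomial.X ⟨i, j i⟩) := rfl

/-- The map from the coordinate ring of the chart `U_j` to the localization of the Cox ring which
sends `x_{i,l}` to `x_{i,l} / x_{i,j_i}`. -/
def homogenize (k : Type u) [Field k] (j : ∀ i, Fin (n i + 1)) :
    ChartRing k j →ₐ[k] CoxLocalization k j :=
  MvPolynomial.aeval fun p => ((chartUnit k j p.1.1)⁻¹ : (CoxLocalization k j)ˣ) *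
    toCoxLocalization k j (MvPolynomial.X p.1)

/-- The composite divides each variable by the unit `x_{i,j_i}` of its block, so on multidegree `d`
it only introduces the unit factor `∏ x_{i,j_i}^{-d_i}`. -/
lemma homogenize_dehomogenize {f : CoxRing k n} {d : Fin m → ℕ}
    (hf : MvPolynomial.IsWeightedHomogeneous
      (fun p : (Σ i : Fin m, Fin (n i + 1)) => (Pi.single p.1 1 : Fin m → ℕ)) f d) :
    homogenize k j (dehomogenize k j f) =
      ((∏ i, (chartUnit k j i)⁻¹ ^ d i : (CoxLocalization k j)ˣ) : CoxLocalization k j) *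
        toCoxLocalization k j f := by
  have h1 : (homogenize k j).comp (dehomogenize k j) =
      MvPolynomial.aeval fun p => ((fun i => ((chartUnit k j i)⁻¹ : (CoxLocalization k j)ˣ)) p.1 :
        CoxLocalization k j) * (fun p => toCoxLocalization k j (MvPolynomial.X p)) p := by
    ext p
    by_cases hp : p.2 = j p.1
    · have : p = ⟨p.1, j p.1⟩ := by rw [← hp]
      simp only [AlgHom.comp_apply, dehomogenize, MvPolynomial.aeval_X, hp, ne_eq,
        not_true_eq_false, dite_false, map_one]
      rw [this, ← coe_chartUnit, Units.inv_mul]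
    · simp [dehomogenize, homogenize, hp]
  rw [← AlgHom.comp_apply, h1, aeval_mul_of_isWeightedHomogeneous hf
    (fun i => (((chartUnit k j i)⁻¹ : (CoxLocalization k j)ˣ) : CoxLocalization k j)),
    Units.coe_prod]
  simp only [Units.val_pow_eq_pow_val]
  congr 1
  exact (DFunLike.congr_fun (MvPolynomial.aeval_unique (toCoxLocalization k j)) f).symm

/-- If the dehomogenization of a multihomogeneous `r` lies in the ideal generated by the
dehomogenizations of the `f a`, then `r` times a power of the chart monomial lies in `(f)`. -/
lemma exists_chartMonomial_pow_mul_mem {s : ℕ} {f : Fin s → CoxRing k n}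
    (hf : ∀ a, IsMultihomogeneous (f a)) {r : CoxRing k n} (hr : IsMultihomogeneous r)
    (h : dehomogenize k j r ∈ Ideal.span (Set.range fun a => dehomogenize k j (f a))) :
    ∃ N : ℕ, chartMonomial k j ^ N * r ∈ Ideal.span (Set.range f) := by
  have h1 := Ideal.mem_map_of_mem (homogenize k j) h
  rw [Ideal.map_span, ← Set.range_comp] at h1
  have hle : Ideal.span (Set.range (homogenize k j ∘ fun a => dehomogenize k j (f a))) ≤
      (Ideal.span (Set.range f)).map (algebraMap (CoxRing k n) (CoxLocalization k j)) := by
    rw [Ideal.span_le]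
    rintro _ ⟨a, rfl⟩
    obtain ⟨d, hd⟩ := hf a
    simp only [Function.comp_apply, homogenize_dehomogenize j hd]
    exact Ideal.mul_mem_left _ _ (Ideal.mem_map_of_mem _ (Ideal.subset_span ⟨a, rfl⟩))
  obtain ⟨d, hd⟩ := hr
  have h2 := hle h1
  rw [homogenize_dehomogenize j hd, Ideal.unit_mul_mem_iff_mem _ (Units.isUnit _),
    toCoxLocalization_apply, IsLocalization.algebraMap_mem_map_algebraMap_iff
      (Submonoid.powers (chartMonomial k j))] at h2
  obtain ⟨_, ⟨N, rfl⟩, hN⟩ := h2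
  exact ⟨N, hN⟩

lemma isUnit_aeval_of_mem_powers {C : Type*} [CommRing C] [Algebra k C]
    (φ : CoxRing k n →ₐ[k] C) (h : ∀ i, IsUnit (φ (MvPolynomial.X ⟨i, j i⟩)))
    (y : Submonoid.powers (chartMonomial k j)) : IsUnit (φ y) := by
  obtain ⟨_, N, rfl⟩ := y
  simp only [map_pow, chartMonomial, map_prod]
  exact (IsUnit.prod_univ_iff.mpr h).pow N

/-- The endomorphism of the localized Cox ring fixing the variables `x_{i,j_i}` and multiplying
the other variables of the `i`-th block by `x_{i,j_i} ^ e`. -/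
def rescale (k : Type u) [Field k] (j : ∀ i, Fin (n i + 1)) (e : ℤ) :
    CoxLocalization k j →ₐ[k] CoxLocalization k j :=
  IsLocalization.liftAlgHom (M := Submonoid.powers (chartMonomial k j))
    (f := (MvPolynomial.aeval fun p : (Σ i : Fin m, Fin (n i + 1)) =>
      if p.2 = j p.1 then toCoxLocalization k j (MvPolynomial.X p)
        else ((chartUnit k j p.1 ^ e : (CoxLocalization k j)ˣ) : CoxLocalization k j) *
          toCoxLocalization k j (MvPolynomial.X p)))
    (isUnit_aeval_of_mem_powers j _ fun i => by simpa using isUnit_toCoxLocalization_X j i)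

lemma rescale_X (e : ℤ) (p : Σ i : Fin m, Fin (n i + 1)) :
    rescale k j e (toCoxLocalization k j (MvPolynomial.X p)) =
      if p.2 = j p.1 then toCoxLocalization k j (MvPolynomial.X p)
        else ((chartUnit k j p.1 ^ e : (CoxLocalization k j)ˣ) : CoxLocalization k j) *
          toCoxLocalization k j (MvPolynomial.X p) := by
  rw [rescale, IsLocalization.liftAlgHom_apply, toCoxLocalization_apply, IsLocalization.lift_eq]
  simp [toCoxLocalization_apply]

lemma rescale_chartUnit_zpow (e c : ℤ) (i : Fin m) :
    rescale k j e ((chartUnit k j i ^ c : (CoxLocalization k j)ˣ) : CoxLocalization k j) =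
      ((chartUnit k j i ^ c : (CoxLocalization k j)ˣ) : CoxLocalization k j) := by
  have h : Units.map (rescale k j e : CoxLocalization k j →* CoxLocalization k j)
      (chartUnit k j i) = chartUnit k j i := by
    ext
    rw [Units.coe_map, coe_chartUnit]
    exact (rescale_X j e _).trans (by simp)
  have := congrArg Units.val (map_zpow (Units.map (rescale k j e :
    CoxLocalization k j →* CoxLocalization k j)) (chartUnit k j i) c)
  rw [h] at this
  exact this

lemma rescale_comp_rescale_neg (e : ℤ) :
    (rescale k j e).comp (rescale k j (-e)) = AlgHom.id k _ := by
  refine IsLocalization.algHom_ext (Submonoid.powers (chartMonomial k j)) ?_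
  change _ = (AlgHom.id k _).comp (toCoxLocalization k j)
  change ((rescale k j e).comp (rescale k j (-e))).comp (toCoxLocalization k j) = _
  ext p
  simp only [AlgHom.comp_apply, rescale_X, AlgHom.id_apply]
  split_ifs with h
  · rw [rescale_X, if_pos h]
  · rw [map_mul, rescale_chartUnit_zpow, rescale_X, if_neg h, ← mul_assoc, ← Units.val_mul,
      ← zpow_add]
    simp

/-- The automorphism of the localized Cox ring with `x_{i,l} ↦ x_{i,l} / x_{i,j_i}` for
`l ≠ j_i` and `x_{i,j_i} ↦ x_{i,j_i}`. -/
def rescaleEquiv (k : Type u) [Field k] (j : ∀ i, Fin (n i + 1)) :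
    CoxLocalization k j ≃ₐ[k] CoxLocalization k j :=
  AlgEquiv.ofAlgHom (rescale k j (-1)) (rescale k j 1) (rescale_comp_rescale_neg j (-1))
    (rescale_comp_rescale_neg j 1)

/-- The prime `p` is the contraction of the localized `P` along `homogenize`. That map is the
inclusion of a polynomial subring followed by the automorphism `rescaleEquiv`. Localization and
automorphism preserve the height, and contraction to the subring does not increase it. -/
lemma exists_prime_height_le (P : Ideal (CoxRing k n)) [hP : P.IsPrime]
    (hj : chartMonomial k j ∉ P) :
    ∃ p : Ideal (ChartRing k j), p.IsPrime ∧ p.height ≤ P.height ∧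
      ∀ f : CoxRing k n, IsMultihomogeneous f → f ∈ P → dehomogenize k j f ∈ p := by
  have hdisj : Disjoint (Submonoid.powers (chartMonomial k j) : Set (CoxRing k n)) P :=
    (Ideal.disjoint_powers_iff_notMem _ hP.isRadical).mpr hj
  let PS : Ideal (CoxLocalization k j) := P.map (algebraMap (CoxRing k n) (CoxLocalization k j))
  have hPS : PS.IsPrime := IsLocalization.isPrime_of_isPrime_disjoint _ _ P hP hdisj
  let Q : Ideal (CoxLocalization k j) := PS.comap (rescaleEquiv k j).toRingEquiv
  have hQ : Q.IsPrime := inferInstance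
  let QR : Ideal (CoxRing k n) := Q.under (CoxRing k n)
  have hQR : QR.IsPrime := inferInstance
  have hht : QR.height = P.height := by
    rw [IsLocalization.height_under (Submonoid.powers (chartMonomial k j)), RingEquiv.height_comap,
      IsLocalization.height_map_of_disjoint _ _ hdisj]
  refine ⟨QR.comap (MvPolynomial.rename
    (Subtype.val : {p : (Σ i : Fin m, Fin (n i + 1)) // p.2 ≠ j p.1} → _) :
      ChartRing k j →ₐ[k] CoxRing k n), inferInstance,
    (MvPolynomial.height_comap_rename_subtypeVal_le _ QR).trans hht.le, ?_⟩
  rintro f ⟨d, hd⟩ hfP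
  have hψ : ((rescale k j (-1)).comp (toCoxLocalization k j)).comp (MvPolynomial.rename (R := k)
      (Subtype.val : {p : (Σ i : Fin m, Fin (n i + 1)) // p.2 ≠ j p.1} → _)) =
        homogenize k j := by
    ext p
    simp [rescale_X, homogenize, p.2]
  change (((rescale k j (-1)).comp (toCoxLocalization k j)).comp (MvPolynomial.rename (R := k)
      (Subtype.val : {p : (Σ i : Fin m, Fin (n i + 1)) // p.2 ≠ j p.1} → _)))
        (dehomogenize k j f) ∈ PS
  rw [hψ, homogenize_dehomogenize j hd]
  exact Ideal.mul_mem_left _ _ (Ideal.mem_map_of_mem _ hfP)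

end Localization

lemma card_chartRing_variables (j : ∀ i, Fin (n i + 1)) :
    Nat.card {p : (Σ i : Fin m, Fin (n i + 1)) // p.2 ≠ j p.1} = ∑ i, n i := by
  let e : {p : (Σ i : Fin m, Fin (n i + 1)) // p.2 ≠ j p.1} ≃
      Σ i : Fin m, {l : Fin (n i + 1) // l ≠ j i} :=
    { toFun := fun p => ⟨p.1.1, p.1.2, p.2⟩
      invFun := fun q => ⟨⟨q.1, q.2.1⟩, q.2.2⟩
      left_inv := fun _ => rfl
      right_inv := fun _ => rfl }
  rw [Nat.card_congr e, Nat.card_eq_fintype_card, Fintype.card_sigma]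
  refine Finset.sum_congr rfl fun i _ => ?_
  rw [Fintype.card_subtype_compl]
  simp

/-- A prime containing a whole block of variables `x_{i,0}, …, x_{i,n_i}` has height greater
than `n_i`. -/
lemma lt_height_of_forall_X_mem (P : Ideal (CoxRing k n)) [hP : P.IsPrime] (i : Fin m)
    (hi : ∀ l, MvPolynomial.X ⟨i, l⟩ ∈ P) : (n i : ℕ∞) < P.height := by
  -- Modulo `P` the `i`-th block vanishes, so `R/P` is a quotient of the polynomial ring in the
  -- other variables and its dimension is at most their number. The height of `P` accounts for the
  -- remaining `n i + 1`.
  let q : (Σ i : Fin m, Fin (n i + 1)) → Prop := fun p => p.1 ≠ i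
  let φ : MvPolynomial (Subtype q) k →ₐ[k] CoxRing k n ⧸ P :=
    (Ideal.Quotient.mkₐ k P).comp (MvPolynomial.rename Subtype.val)
  have hφ : Function.Surjective φ := by
    have h : φ.range = ⊤ := by
      rw [← top_le_iff]
      have h1 : (⊤ : Subalgebra k (CoxRing k n ⧸ P)) =
          (Algebra.adjoin k (Set.range MvPolynomial.X)).map (Ideal.Quotient.mkₐ k P) := by
        rw [MvPolynomial.adjoin_range_X, Algebra.map_top]
        exact ((AlgHom.range_eq_top _).mpr (Ideal.Quotient.mkₐ_surjective k P)).symm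
      rw [h1, AlgHom.map_adjoin, Algebra.adjoin_le_iff]
      rintro _ ⟨_, ⟨p, rfl⟩, rfl⟩
      by_cases hp : p.1 = i
      · have : Ideal.Quotient.mkₐ k P (MvPolynomial.X p) = 0 := by
          obtain ⟨i', l⟩ := p
          obtain rfl : i' = i := hp
          exact Ideal.Quotient.eq_zero_iff_mem.mpr (hi l)
        rw [this]
        exact zero_mem φ.range
      · exact ⟨MvPolynomial.X ⟨p, hp⟩, by simp [φ]⟩
    exact AlgHom.range_eq_top _ |>.mp h
  have h1 := ringKrullDim_le_of_surjective φ.toRingHom hφ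
  rw [MvPolynomial.ringKrullDim_of_isNoetherianRing, ringKrullDim_eq_zero_of_field, zero_add] at h1
  have h2 := MvPolynomial.card_le_height_add_ringKrullDim k _ P
  have h3 : Nat.card (Σ i : Fin m, Fin (n i + 1)) = Nat.card (Subtype q) + (n i + 1) := by
    classical
    have h4 : Nat.card {p : (Σ i : Fin m, Fin (n i + 1)) // ¬ q p} = n i + 1 := by
      let e : {p : (Σ i : Fin m, Fin (n i + 1)) // ¬ q p} ≃ Fin (n i + 1) :=
        { toFun := fun p => (not_not.mp p.2) ▸ p.1.2
          invFun := fun l => ⟨⟨i, l⟩, not_not.mpr rfl⟩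
          left_inv := by
            rintro ⟨⟨i', l⟩, h⟩
            obtain rfl : i' = i := not_not.mp h
            rfl
          right_inv := fun l => rfl }
      rw [Nat.card_congr e, Nat.card_eq_fintype_card, Fintype.card_fin]
    rw [← h4, ← Nat.card_sum]
    exact Nat.card_congr (Equiv.sumCompl q).symm
  have h5 := h2.trans (add_le_add_right h1 _)
  rw [h3] at h5
  have h6 : ((Nat.card (Subtype q) + (n i + 1) : ℕ) : ℕ∞) ≤ P.height + Nat.card (Subtype q) := by
    exact_mod_cast h5
  by_contra! hcon
  have h7 := h6.trans (add_le_add_left hcon _)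
  have h8 : Nat.card (Subtype q) + (n i + 1) ≤ n i + Nat.card (Subtype q) := by exact_mod_cast h7
  omega

/-- If `f_1, …, f_s` cut out a subscheme of codimension `s` in each chart, then the ideal
`(f_1, …, f_s)` of the Cox ring contains all `r` which it contains up to powers of the chart
monomials. -/
lemma mem_span_of_forall_chartMonomial_pow_mul_mem {s : ℕ} (hs : ∀ i, s ≤ n i)
    {f : Fin s → CoxRing k n} (hf : ∀ a, IsMultihomogeneous (f a))
    (hdim : ∀ (j : ∀ i, Fin (n i + 1)) (p : Ideal (ChartRing k j)), p.IsPrime →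
      (∀ a, dehomogenize k j (f a) ∈ p) →
      ringKrullDim (ChartRing k j ⧸ p) + s ≤ ((∑ i, n i : ℕ) : WithBot ℕ∞))
    {r : CoxRing k n} (hr : ∀ j, ∃ N : ℕ, chartMonomial k j ^ N * r ∈ Ideal.span (Set.range f)) :
    r ∈ Ideal.span (Set.range f) := by
  have key : ∀ P : Ideal (CoxRing k n), P.IsPrime → (∀ j, chartMonomial k j ∈ P) →
      (s : ℕ∞) < P.height := by
    intro P hP hj
    -- Otherwise each block has a variable outside `P`, and their product is a chart monomial
    -- outside the prime `P`.
    have : ∃ i, ∀ l, MvPolynomial.X ⟨i, l⟩ ∈ P := by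
      by_contra! hcon
      choose j hjP using hcon
      obtain ⟨i, -, hi⟩ := (hP.prod_mem_iff).mp (hj j)
      exact hjP i hi
    obtain ⟨i, hi⟩ := this
    exact lt_of_le_of_lt (by exact_mod_cast hs i) (lt_height_of_forall_X_mem P i hi)
  refine (MvPolynomial.hasRegularSequencesOfHeight k _).mem_span_range_of_forall_lt_height f
    (fun P hP hfP => ?_) fun P hP hrP => key P hP fun j => ?_
  · by_cases hj : ∀ j, chartMonomial k j ∈ P
    · exact (key P hP hj).le
    · push Not at hj
      obtain ⟨j, hj⟩ := hj
      obtain ⟨p, hp, hle, hmem⟩ := exists_prime_height_le j P hj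
      have h1 := hdim j p hp fun a => hmem _ (hf a) (hfP (Ideal.subset_span ⟨a, rfl⟩))
      have h2 := MvPolynomial.card_le_height_add_ringKrullDim k _ p
      rw [card_chartRing_variables] at h2
      have h3 : ringKrullDim (ChartRing k j ⧸ p) ≤ ((∑ i, n i : ℕ) : WithBot ℕ∞) :=
        (le_add_of_nonneg_right (by positivity)).trans h1
      refine le_trans ?_ hle
      have : Nontrivial (ChartRing k j ⧸ p) := Ideal.Quotient.nontrivial_iff.mpr hp.ne_top
      -- The dimension is not `⊥` by `h2` and not `⊤` by `h3`, so it is a natural number and can be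
      -- cancelled.
      generalize ringKrullDim (ChartRing k j ⧸ p) = D at *
      induction D with
      | bot =>
        rw [WithBot.add_bot, le_bot_iff] at h2
        exact absurd h2 WithBot.coe_ne_bot
      | coe D =>
        lift D to ℕ using fun h => by
          subst h
          have h4 : (⊤ : ℕ∞) ≤ ((∑ i, n i : ℕ) : ℕ∞) := WithBot.coe_le_coe.mp h3
          exact ENat.natCast_ne_top _ (top_le_iff.mp h4)
        have h4 : D + s ≤ ∑ i, n i := by exact_mod_cast h1
        have h5 : ((∑ i, n i : ℕ) : ℕ∞) ≤ p.height + D := by exact_mod_cast h2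
        have h6 : (s : ℕ∞) + D ≤ p.height + D :=
          le_trans (by exact_mod_cast (add_comm s D).trans_le h4) h5
        exact (ENat.add_le_add_iff_right (ENat.natCast_ne_top D)).mp h6
  · obtain ⟨N, hN⟩ := hr j
    exact hP.mem_of_pow_mem N (hrP _ hN)

end MultiProj

/-! ### Krull dimension of a space covered by charts. -/

section Dimension

open TopologicalSpace in
/-- A space covered by open subspaces of dimension at most `d` has dimension at most `d`. -/
lemma topologicalKrullDim_le_of_isOpenEmbedding {X : Type*} [TopologicalSpace X] {ι : Type*}
    {U : ι → Type*} [∀ i, TopologicalSpace (U i)] (f : ∀ i, U i → X)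
    (hf : ∀ i, Topology.IsOpenEmbedding (f i)) (hcov : ∀ x, ∃ i, x ∈ Set.range (f i))
    {d : WithBot ℕ∞} (hd : ∀ i, topologicalKrullDim (U i) ≤ d) : topologicalKrullDim X ≤ d := by
  -- Every irreducible closed set above `Z` also meets a chart that meets `Z`, so the coheight of
  -- `Z` can be computed in that chart.
  rw [topologicalKrullDim, Order.krullDim_eq_iSup_coheight]
  refine iSup_le fun Z => ?_
  obtain ⟨x, hx⟩ := Z.isIrreducible.nonempty
  obtain ⟨i, y, rfl⟩ := hcov x
  have hZ : (f i ⁻¹' (Z : Set X)).Nonempty := ⟨y, hx⟩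
  obtain ⟨T, hT⟩ := (IrreducibleCloseds.orderIsoOfIsOpenEmbedding (f i) (hf i)).surjective ⟨Z, hZ⟩
  have hT' : IrreducibleCloseds.map (f i) (hf i).continuous T = Z := congrArg Subtype.val hT
  rw [← hT', (hf i).coheight_map]
  exact (Order.coheight_le_krullDim T).trans (hd i)

end Dimension

/-! ### Morphisms to affine schemes as ring homomorphisms. -/

namespace AlgebraicGeometry.Scheme

/-- The ring homomorphism corresponding to a morphism to an affine scheme. -/
def Hom.toRingHom {T : Scheme.{u}} {C : Type u} [CommRing C] (g : T ⟶ Spec (CommRingCat.of C)) :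
    C →+* Γ(T, ⊤) :=
  ((ΓSpecIso (CommRingCat.of C)).inv ≫ g.appTop).hom

lemma Hom.toRingHom_injective {T : Scheme.{u}} {C : Type u} [CommRing C]
    {g g' : T ⟶ Spec (CommRingCat.of C)} (h : Hom.toRingHom g = Hom.toRingHom g') : g = g' := by
  refine ext_of_isAffine ?_
  have h' := CommRingCat.hom_ext h
  exact (cancel_epi _).mp h'

lemma Hom.toRingHom_comp_specMap {T : Scheme.{u}} {B C : Type u} [CommRing B] [CommRing C]
    (g : T ⟶ Spec (CommRingCat.of C)) (φ : B →+* C) :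
    Hom.toRingHom (g ≫ Spec.map (CommRingCat.ofHom φ)) = (Hom.toRingHom g).comp φ := by
  rw [toRingHom, Scheme.Hom.comp_appTop, ← ΓSpecIso_inv_naturality_assoc]
  rfl

lemma Hom.toRingHom_comp {T T' : Scheme.{u}} {C : Type u} [CommRing C] (h : T' ⟶ T)
    (g : T ⟶ Spec (CommRingCat.of C)) :
    Hom.toRingHom (h ≫ g) = h.appTop.hom.comp (Hom.toRingHom g) := by
  rw [toRingHom, Scheme.Hom.comp_appTop]
  rfl

lemma Hom.exists_toRingHom_eq {T : Scheme.{u}} {C : Type u} [CommRing C] (φ : C →+* Γ(T, ⊤)) :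
    ∃ g : T ⟶ Spec (CommRingCat.of C), Hom.toRingHom g = φ := by
  refine ⟨T.toSpecΓ ≫ Spec.map (CommRingCat.ofHom φ), ?_⟩
  have := Hom.toRingHom_comp_specMap (C := Γ(T, ⊤)) T.toSpecΓ φ
  refine this.trans ?_
  have h1 : Hom.toRingHom (C := Γ(T, ⊤)) T.toSpecΓ = RingHom.id _ := by
    have h2 : (ΓSpecIso Γ(T, ⊤)).inv ≫ T.toSpecΓ.appTop = 𝟙 _ := by simp
    exact congrArg CommRingCat.Hom.hom h2
  rw [h1]; rfl

end AlgebraicGeometry.Scheme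

namespace MultiProj

attribute [local instance] MvPolynomial.gradedAlgebra

/-! ### Coordinate rings of the standard charts of projective space. -/

section Away

variable (k : Type u) [Field k] {N : ℕ}

/-- The coordinate ring of the standard chart `{x_{l₀} ≠ 0}` of projective space. -/
abbrev AwayRing (l₀ : Fin (N + 1)) : Type u :=
  HomogeneousLocalization.Away (MvPolynomial.homogeneousSubmodule (Fin (N + 1)) k)
    (MvPolynomial.X l₀)

/-- The constants in a homogeneous localization of the polynomial ring. -/
def awayConst (x : MvPolynomial (Fin (N + 1)) k) : k →+* HomogeneousLocalization.Away
    (MvPolynomial.homogeneousSubmodule (Fin (N + 1)) k) x :=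
  (HomogeneousLocalization.fromZeroRingHom
      (MvPolynomial.homogeneousSubmodule (Fin (N + 1)) k) (Submonoid.powers x)).comp
    (algebraMap k (MvPolynomial.homogeneousSubmodule (Fin (N + 1)) k 0))

lemma val_awayConst (x : MvPolynomial (Fin (N + 1)) k) (c : k) :
    (awayConst k x c).val = algebraMap k (Localization.Away x) c := by
  rw [IsScalarTower.algebraMap_apply k (MvPolynomial (Fin (N + 1)) k) (Localization.Away x),
    ← Localization.mk_one_eq_algebraMap]
  rfl

/-- The coordinate `x_l / x_{l₀}` on the standard chart `{x_{l₀} ≠ 0}`. -/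
def awayRatio (l₀ l : Fin (N + 1)) : AwayRing k l₀ :=
  HomogeneousLocalization.Away.mk _ (X_mem_homogeneousSubmodule k l₀) 1 (MvPolynomial.X l)
    (X_mem_homogeneousSubmodule k l)

lemma val_awayRatio (l₀ l : Fin (N + 1)) :
    (awayRatio k l₀ l).val = Localization.mk (MvPolynomial.X l)
      ⟨(MvPolynomial.X l₀ : MvPolynomial (Fin (N + 1)) k) ^ 1, by use 1⟩ := by
  rw [awayRatio, HomogeneousLocalization.Away.val_mk]

lemma algebraMap_mul_val_awayRatio (l₀ l : Fin (N + 1)) :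
    algebraMap (MvPolynomial (Fin (N + 1)) k)
      (Localization.Away (MvPolynomial.X l₀ : MvPolynomial (Fin (N + 1)) k))
      (MvPolynomial.X l₀) * (awayRatio k l₀ l).val =
    algebraMap (MvPolynomial (Fin (N + 1)) k) _ (MvPolynomial.X l) := by
  have h := IsLocalization.mk'_spec' (Localization.Away
    (MvPolynomial.X l₀ : MvPolynomial (Fin (N + 1)) k)) (MvPolynomial.X l)
    (⟨(MvPolynomial.X l₀ : MvPolynomial (Fin (N + 1)) k) ^ 1, by use 1⟩ :
      Submonoid.powers (MvPolynomial.X l₀ : MvPolynomial (Fin (N + 1)) k))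
  rw [val_awayRatio, Localization.mk_eq_mk', ← h]
  simp only [pow_one]

lemma awayRatio_self (l₀ : Fin (N + 1)) : awayRatio k l₀ l₀ = 1 := by
  apply HomogeneousLocalization.val_injective
  have h := algebraMap_mul_val_awayRatio k l₀ l₀
  rw [HomogeneousLocalization.val_one]
  exact (IsLocalization.Away.algebraMap_isUnit (S := Localization.Away
    (MvPolynomial.X l₀ : MvPolynomial (Fin (N + 1)) k)) (MvPolynomial.X l₀)).mul_left_cancel
    (by rw [h, mul_one])

lemma aeval_mul_of_isHomogeneous {C : Type*} [CommRing C] [Algebra k C]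
    {f : MvPolynomial (Fin (N + 1)) k} {d : ℕ} (hf : f.IsHomogeneous d) (u : C)
    (v : Fin (N + 1) → C) :
    MvPolynomial.aeval (fun l => u * v l) f = u ^ d * MvPolynomial.aeval v f := by
  rw [MvPolynomial.aeval_def, MvPolynomial.aeval_def, MvPolynomial.eval₂_eq',
    MvPolynomial.eval₂_eq', Finset.mul_sum]
  refine Finset.sum_congr rfl fun e he => ?_
  have hd : ∑ i, e i = d := by
    rw [← hf (MvPolynomial.mem_support_iff.mp he), Finsupp.weight_apply,
      Finsupp.sum_fintype _ _ (by simp)]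
    simp
  simp_rw [mul_pow, Finset.prod_mul_distrib, Finset.prod_pow_eq_pow_sum, hd]
  ring

/-- An element is `f / x_{l₀}^d` with `f` homogeneous of degree `d`, which is `f` evaluated at the
ratios `x_l / x_{l₀}`. -/
lemma exists_eq_eval₂_awayRatio (l₀ : Fin (N + 1)) (z : AwayRing k l₀) :
    ∃ f : MvPolynomial (Fin (N + 1)) k,
      z = MvPolynomial.eval₂ (awayConst k (MvPolynomial.X l₀)) (awayRatio k l₀) f := by
  obtain ⟨d, f, hf, rfl⟩ := HomogeneousLocalization.Away.mk_surjective _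
    (X_mem_homogeneousSubmodule k l₀) z
  refine ⟨f, HomogeneousLocalization.val_injective _ ?_⟩
  set S := Localization.Away (MvPolynomial.X l₀ : MvPolynomial (Fin (N + 1)) k) with hS
  have hcomp : (MvPolynomial.eval₂ (awayConst k (MvPolynomial.X l₀)) (awayRatio k l₀) f).val =
      MvPolynomial.aeval (fun l => (awayRatio k l₀ l).val) f := by
    have h1 := MvPolynomial.hom_eval₂ f (awayConst k (MvPolynomial.X l₀))
      (algebraMap (AwayRing k l₀) S) (awayRatio k l₀)
    rw [HomogeneousLocalization.algebraMap_apply] at h1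
    rw [h1, MvPolynomial.aeval_def]
    exact congrArg (fun φ => MvPolynomial.eval₂ φ _ f) (RingHom.ext (val_awayConst k _))
  have hf' : f.IsHomogeneous d := by simpa using hf
  have h2 := aeval_mul_of_isHomogeneous k hf' (algebraMap (MvPolynomial (Fin (N + 1)) k) S (MvPolynomial.X l₀))
    (fun l => (awayRatio k l₀ l).val)
  simp_rw [S, algebraMap_mul_val_awayRatio] at h2
  have h3 : MvPolynomial.aeval (fun l => algebraMap (MvPolynomial (Fin (N + 1)) k) S
      (MvPolynomial.X l)) f = algebraMap _ S f := by
    have := MvPolynomial.aeval_algebraMap_apply (A := MvPolynomial (Fin (N + 1)) k) S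
      MvPolynomial.X f
    refine this.trans ?_
    rw [MvPolynomial.aeval_X_left_apply]
  rw [hcomp, HomogeneousLocalization.Away.val_mk, Localization.mk_eq_mk',
    IsLocalization.mk'_eq_iff_eq_mul, mul_comm]
  rw [← h3, h2, map_pow]

lemma awayRing_hom_ext {l₀ : Fin (N + 1)} {C : Type*} [CommRing C] {α β : AwayRing k l₀ →+* C}
    (hc : α.comp (awayConst k _) = β.comp (awayConst k _))
    (hr : ∀ l, α (awayRatio k l₀ l) = β (awayRatio k l₀ l)) : α = β := by
  ext z
  obtain ⟨f, rfl⟩ := exists_eq_eval₂_awayRatio k l₀ z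
  rw [MvPolynomial.hom_eval₂, MvPolynomial.hom_eval₂, hc]
  congr 1
  exact funext hr

end Away

/-! ### The standard charts form an affine open cover of the product. -/

section Charts

variable (k : Type u) [Field k] {m : ℕ} {n : Fin m → ℕ} (j : ∀ i, Fin (n i + 1))

lemma chartRingMap_awayConst (i : Fin m) :
    (chartRingMap k j i).comp (awayConst k _) = algebraMap k (ChartRing k j) := by
  ext1 c
  have h : (awayConst k (MvPolynomial.X (j i)) c).val =
      algebraMap (MvPolynomial (Fin (n i + 1)) k) (Localization.Away
        (MvPolynomial.X (j i) : MvPolynomial (Fin (n i + 1)) k)) (algebraMap k _ c) := by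
    rw [val_awayConst]; rfl
  rw [RingHom.comp_apply, chartRingMap, RingHom.comp_apply,
    HomogeneousLocalization.algebraMap_apply, h, IsLocalization.Away.lift_eq]
  exact (dehomogenizeFactor k j i).commutes c

lemma chartRingMap_awayRatio (i : Fin m) (l : Fin (n i + 1)) :
    chartRingMap k j i (awayRatio k (j i) l) = dehomogenize k j (MvPolynomial.X ⟨i, l⟩) := by
  have hl : ∀ l', (dehomogenizeFactor k j i).toRingHom (MvPolynomial.X l') =
      dehomogenize k j (MvPolynomial.X ⟨i, l'⟩) := fun l' => by
    simp [dehomogenizeFactor]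
  have hu : IsUnit ((dehomogenizeFactor k j i).toRingHom (MvPolynomial.X (j i))) := by
    have h := dehomogenizeFactor_X k j i
    simp only [AlgHom.toRingHom_eq_coe, RingHom.coe_coe, h, isUnit_one]
  have h1 := congrArg (IsLocalization.Away.lift (S := Localization.Away
      (MvPolynomial.X (j i) : MvPolynomial (Fin (n i + 1)) k)) (MvPolynomial.X (j i))
      (g := (dehomogenizeFactor k j i).toRingHom) hu) (algebraMap_mul_val_awayRatio k (j i) l)
  rw [map_mul, IsLocalization.Away.lift_eq, IsLocalization.Away.lift_eq, hl l] at h1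
  have h2 : (dehomogenizeFactor k j i).toRingHom (MvPolynomial.X (j i)) = 1 :=
    dehomogenizeFactor_X k j i
  rw [h2, one_mul] at h1
  exact h1

lemma chart_π (i : Fin m) :
    chart k j ≫ Limits.WidePullback.π (fun i => projSpaceStr k (n i)) i = chartProj k j i :=
  Limits.WidePullback.lift_π _ _ _ (chartProj_projSpaceStr k j) i

lemma chart_base :
    chart k j ≫ Limits.WidePullback.base (fun i => projSpaceStr k (n i)) =
      Spec.map (CommRingCat.ofHom (algebraMap k (ChartRing k j))) :=
  Limits.WidePullback.lift_base _ _ _ (chartProj_projSpaceStr k j)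

lemma awayι_projSpaceStr {N : ℕ} (l₀ : Fin (N + 1)) :
    Proj.awayι (MvPolynomial.homogeneousSubmodule (Fin (N + 1)) k) (MvPolynomial.X l₀)
      (X_mem_homogeneousSubmodule k l₀) one_pos ≫ projSpaceStr k N =
      Spec.map (CommRingCat.ofHom (awayConst k (MvPolynomial.X l₀))) := by
  rw [projSpaceStr, Proj.awayι_toSpecZero_assoc, ← Spec.map_comp, ← CommRingCat.ofHom_comp]
  rfl

lemma dehomogenize_X_ne (p : {p : (Σ i : Fin m, Fin (n i + 1)) // p.2 ≠ j p.1}) :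
    dehomogenize k j (MvPolynomial.X p.1) = MvPolynomial.X p := by
  rw [dehomogenize, MvPolynomial.aeval_X, dif_pos p.2]

/-- A morphism to the chart is determined by the constants, visible through the base, and by the
coordinates, which are ratios pulled back along the projections. -/
instance mono_chart : Mono (chart k j) where
  right_cancellation {T} g g' h := by
    apply Scheme.Hom.toRingHom_injective
    have hb := congrArg (· ≫ Limits.WidePullback.base (fun i => projSpaceStr k (n i))) h
    simp only [Category.assoc, chart_base] at hb
    have hb' := congrArg Scheme.Hom.toRingHom hb
    rw [Scheme.Hom.toRingHom_comp_specMap, Scheme.Hom.toRingHom_comp_specMap] at hb'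
    refine MvPolynomial.ringHom_ext (fun c => RingHom.congr_fun hb' c) fun p => ?_
    have hp := congrArg (· ≫ Limits.WidePullback.π (fun i => projSpaceStr k (n i)) p.1.1) h
    simp only [Category.assoc, chart_π, chartProj] at hp
    rw [← Category.assoc, ← Category.assoc, cancel_mono] at hp
    have hp' := congrArg Scheme.Hom.toRingHom hp
    rw [Scheme.Hom.toRingHom_comp_specMap, Scheme.Hom.toRingHom_comp_specMap] at hp'
    have := RingHom.congr_fun hp' (awayRatio k (j p.1.1) p.1.2)
    rw [RingHom.comp_apply, RingHom.comp_apply, chartRingMap_awayRatio] at this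
    rw [← dehomogenize_X_ne]
    exact this

variable {k} in
/-- A morphism to the product of projective spaces whose components factor through the standard
charts factors through the product chart. -/
lemma exists_comp_chart_eq {T : Scheme.{u}} (q : T ⟶ multiProjSpace k n)
    (b : ∀ i, T ⟶ Spec (CommRingCat.of (AwayRing k (j i))))
    (hb : ∀ i, b i ≫ Proj.awayι _ (MvPolynomial.X (j i)) (X_mem_homogeneousSubmodule k (j i))
      one_pos = q ≫ Limits.WidePullback.π (fun i => projSpaceStr k (n i)) i) :
    ∃ g, g ≫ chart k j = q := by
  set κ := Scheme.Hom.toRingHom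
    (q ≫ Limits.WidePullback.base (fun i => projSpaceStr k (n i))) with hκ
  have hbκ : ∀ i, (Scheme.Hom.toRingHom (b i)).comp (awayConst k _) = κ := by
    intro i
    rw [← Scheme.Hom.toRingHom_comp_specMap, ← awayι_projSpaceStr, ← Category.assoc, hb,
      Category.assoc, Limits.WidePullback.π_arrow]
  obtain ⟨g, hg⟩ := Scheme.Hom.exists_toRingHom_eq
    (MvPolynomial.eval₂Hom κ fun p : {p : (Σ i : Fin m, Fin (n i + 1)) // p.2 ≠ j p.1} =>
      Scheme.Hom.toRingHom (b p.1.1) (awayRatio k (j p.1.1) p.1.2))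
  have hgκ : (Scheme.Hom.toRingHom g).comp (algebraMap k (ChartRing k j)) = κ := by
    ext c
    rw [hg, RingHom.comp_apply, MvPolynomial.algebraMap_eq, MvPolynomial.coe_eval₂Hom,
      MvPolynomial.eval₂_C]
  refine ⟨g, Limits.WidePullback.hom_ext _ _ _ (fun i => ?_) ?_⟩
  · rw [Category.assoc, chart_π, ← hb, chartProj, ← Category.assoc]
    congr 1
    apply Scheme.Hom.toRingHom_injective
    rw [Scheme.Hom.toRingHom_comp_specMap]
    refine awayRing_hom_ext k ?_ fun l => ?_
    · rw [RingHom.comp_assoc, chartRingMap_awayConst, hgκ, hbκ]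
    · rw [RingHom.comp_apply, chartRingMap_awayRatio]
      by_cases hl : l = j i
      · subst hl
        rw [awayRatio_self, map_one]
        simp [dehomogenize]
      · rw [dehomogenize_X_ne k j ⟨⟨i, l⟩, hl⟩, hg, MvPolynomial.coe_eval₂Hom,
          MvPolynomial.eval₂_X]
  · apply Scheme.Hom.toRingHom_injective
    rw [Category.assoc, chart_base, Scheme.Hom.toRingHom_comp_specMap, hgκ]

/-- The standard chart as an open subset of the product of projective spaces. -/
def chartOpen : (multiProjSpace k n).Opens :=
  Finset.univ.inf fun i => Limits.WidePullback.π (fun i => projSpaceStr k (n i)) i ⁻¹ᵁ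
    Proj.basicOpen (MvPolynomial.homogeneousSubmodule (Fin (n i + 1)) k) (MvPolynomial.X (j i))

lemma mem_chartOpen (x : multiProjSpace k n) :
    x ∈ chartOpen k j ↔ ∀ i, Limits.WidePullback.π (fun i => projSpaceStr k (n i)) i x ∈
      Proj.basicOpen (MvPolynomial.homogeneousSubmodule (Fin (n i + 1)) k)
        (MvPolynomial.X (j i)) := by
  rw [chartOpen, ← SetLike.mem_coe, TopologicalSpace.Opens.coe_finset_inf]
  simp

lemma range_awayι {N : ℕ} (l₀ : Fin (N + 1)) :
    Set.range (Proj.awayι (MvPolynomial.homogeneousSubmodule (Fin (N + 1)) k) (MvPolynomial.X l₀)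
      (X_mem_homogeneousSubmodule k l₀) one_pos) =
      Proj.basicOpen (MvPolynomial.homogeneousSubmodule (Fin (N + 1)) k) (MvPolynomial.X l₀) := by
  rw [← Proj.opensRange_awayι _ _ (X_mem_homogeneousSubmodule k l₀) one_pos]
  rfl

lemma range_chart_subset : Set.range (chart k j) ⊆ chartOpen k j := by
  rintro _ ⟨x, rfl⟩
  refine (mem_chartOpen k j _).mpr fun i => ?_
  rw [← Scheme.Hom.comp_apply, chart_π, chartProj, Scheme.Hom.comp_apply, ← SetLike.mem_coe,
    ← range_awayι]
  exact ⟨_, rfl⟩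

lemma exists_comp_chart_eq_ι : ∃ e, e ≫ chart k j = (chartOpen k j).ι := by
  have H : ∀ i, Set.range ((chartOpen k j).ι ≫
      Limits.WidePullback.π (fun i => projSpaceStr k (n i)) i) ⊆
      Set.range (Proj.awayι (MvPolynomial.homogeneousSubmodule (Fin (n i + 1)) k)
        (MvPolynomial.X (j i)) (X_mem_homogeneousSubmodule k (j i)) one_pos) := by
    intro i
    rw [range_awayι]
    rintro _ ⟨x, rfl⟩
    exact (mem_chartOpen k j _).mp x.2 i
  exact exists_comp_chart_eq j _ (fun i => IsOpenImmersion.lift _ _ (H i))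
    fun i => IsOpenImmersion.lift_fac _ _ _

/-- The chart and the open inclusion are monomorphisms that factor through each other, so the two
factorizations are mutually inverse. -/
lemma chart_eq_iso_comp_ι :
    ∃ c : Spec (CommRingCat.of (ChartRing k j)) ≅ (chartOpen k j).toScheme,
      chart k j = c.hom ≫ (chartOpen k j).ι := by
  obtain ⟨e, he⟩ := exists_comp_chart_eq_ι k j
  have hc : IsOpenImmersion.lift (chartOpen k j).ι (chart k j)
      (by simpa using range_chart_subset k j) ≫ (chartOpen k j).ι = chart k j :=
    IsOpenImmersion.lift_fac _ _ _
  refine ⟨⟨IsOpenImmersion.lift (chartOpen k j).ι (chart k j) _, e, ?_, ?_⟩, hc.symm⟩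
  · rw [← cancel_mono (chart k j), Category.assoc, he, hc, Category.id_comp]
  · rw [← cancel_mono (chartOpen k j).ι, Category.assoc, hc, he, Category.id_comp]

instance isOpenImmersion_chart : IsOpenImmersion (chart k j) := by
  obtain ⟨c, hc⟩ := chart_eq_iso_comp_ι k j
  rw [hc]
  infer_instance

lemma range_chart : Set.range (chart k j) = chartOpen k j := by
  obtain ⟨c, hc⟩ := chart_eq_iso_comp_ι k j
  refine (range_chart_subset k j).antisymm fun x hx => ?_
  rw [hc]
  let y : (chartOpen k j).toScheme := ⟨x, hx⟩
  refine ⟨c.inv y, ?_⟩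
  rw [← Scheme.Hom.comp_apply, Iso.inv_hom_id_assoc]
  rfl

lemma iSup_basicOpen_X (N : ℕ) :
    ⨆ l : Fin (N + 1), Proj.basicOpen (MvPolynomial.homogeneousSubmodule (Fin (N + 1)) k)
      (MvPolynomial.X l) = ⊤ := by
  refine Proj.iSup_basicOpen_eq_top' _ _ (fun l => ⟨1, X_mem_homogeneousSubmodule k l⟩) ?_
  rw [eq_top_iff]
  intro f _
  induction f using MvPolynomial.induction_on with
  | C c =>
    exact Subalgebra.algebraMap_mem _
      (algebraMap k (MvPolynomial.homogeneousSubmodule (Fin (N + 1)) k 0) c)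
  | add p q hp hq => exact add_mem (hp trivial) (hq trivial)
  | mul_X p l hp => exact mul_mem (hp trivial) (Algebra.subset_adjoin ⟨l, rfl⟩)

lemma exists_mem_range_chart (x : multiProjSpace k n) : ∃ j, x ∈ Set.range (chart k j) := by
  have h : ∀ i, ∃ l, Limits.WidePullback.π (fun i => projSpaceStr k (n i)) i x ∈
      Proj.basicOpen (MvPolynomial.homogeneousSubmodule (Fin (n i + 1)) k)
        (MvPolynomial.X l) := fun i => by
    rw [← TopologicalSpace.Opens.mem_iSup, iSup_basicOpen_X]
    trivial
  choose l hl using h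
  exact ⟨l, by rw [range_chart]; exact (mem_chartOpen k l x).mpr hl⟩

variable (n) in
lemma topologicalKrullDim_multiProjSpace_le :
    topologicalKrullDim (multiProjSpace k n) ≤ ((∑ i, n i : ℕ) : WithBot ℕ∞) := by
  refine topologicalKrullDim_le_of_isOpenEmbedding (fun j => chart k j)
    (fun j => (chart k j).isOpenEmbedding) (exists_mem_range_chart k) fun j => ?_
  have h : topologicalKrullDim (PrimeSpectrum (ChartRing k j)) = _ :=
    PrimeSpectrum.topologicalKrullDim_eq_ringKrullDim _
  refine h.le.trans ?_
  rw [MvPolynomial.ringKrullDim_of_isNoetherianRing, ringKrullDim_eq_zero_of_field, zero_add,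
    card_chartRing_variables]

end Charts

/-! ### Change of chart. -/

section Gluing

variable (k : Type u) [Field k] {m : ℕ} {n : Fin m → ℕ}

lemma awayMap_awayRatio_eq_mul {N : ℕ} (l₀ l₁ l : Fin (N + 1)) :
    HomogeneousLocalization.awayMap _ (X_mem_homogeneousSubmodule k l₁) rfl (awayRatio k l₀ l) =
      HomogeneousLocalization.awayMap _ (X_mem_homogeneousSubmodule k l₁) rfl
        (awayRatio k l₀ l₁) *
      HomogeneousLocalization.awayMap _ (X_mem_homogeneousSubmodule k l₀)
        (mul_comm (MvPolynomial.X l₀ : MvPolynomial (Fin (N + 1)) k) (MvPolynomial.X l₁))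
        (awayRatio k l₁ l) := by
  apply HomogeneousLocalization.val_injective
  rw [HomogeneousLocalization.val_mul, awayRatio, awayRatio, awayRatio,
    HomogeneousLocalization.awayMap_mk, HomogeneousLocalization.awayMap_mk,
    HomogeneousLocalization.awayMap_mk, HomogeneousLocalization.Away.val_mk,
    HomogeneousLocalization.Away.val_mk, HomogeneousLocalization.Away.val_mk,
    Localization.mk_mul, Localization.mk_eq_mk_iff, Localization.r_iff_exists]
  refine ⟨1, ?_⟩
  simp only [OneMemClass.coe_one, Submonoid.coe_mul]
  ring

/-- The homogeneous coordinates of a point lying in two standard charts of projective space are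
proportional. -/
lemma toRingHom_awayRatio_eq_mul {N : ℕ} {l₀ l₁ : Fin (N + 1)} {W : Scheme.{u}}
    (b : W ⟶ Spec (CommRingCat.of (AwayRing k l₀)))
    (b' : W ⟶ Spec (CommRingCat.of (AwayRing k l₁)))
    (h : b ≫ Proj.awayι _ (MvPolynomial.X l₀) (X_mem_homogeneousSubmodule k l₀) one_pos =
      b' ≫ Proj.awayι _ (MvPolynomial.X l₁) (X_mem_homogeneousSubmodule k l₁) one_pos)
    (l : Fin (N + 1)) :
    Scheme.Hom.toRingHom b (awayRatio k l₀ l) =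
      Scheme.Hom.toRingHom b (awayRatio k l₀ l₁) * Scheme.Hom.toRingHom b' (awayRatio k l₁ l) := by
  let e := Proj.pullbackAwayιIso _ (X_mem_homogeneousSubmodule k l₀) one_pos
    (X_mem_homogeneousSubmodule k l₁) one_pos rfl
  let c := Limits.pullback.lift b b' h ≫ e.hom
  have hb : b = c ≫ Spec.map (CommRingCat.ofHom (HomogeneousLocalization.awayMap _
      (X_mem_homogeneousSubmodule k l₁) rfl)) := by
    rw [Category.assoc, Proj.pullbackAwayιIso_hom_SpecMap_awayMap_left, Limits.pullback.lift_fst]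
  have hb' : b' = c ≫ Spec.map (CommRingCat.ofHom (HomogeneousLocalization.awayMap _
      (X_mem_homogeneousSubmodule k l₀)
      (mul_comm (MvPolynomial.X l₀ : MvPolynomial (Fin (N + 1)) k) (MvPolynomial.X l₁)))) := by
    rw [Category.assoc]
    exact ((congrArg (Limits.pullback.lift b b' h ≫ ·)
      (Proj.pullbackAwayιIso_hom_SpecMap_awayMap_right _ (X_mem_homogeneousSubmodule k l₀) one_pos
        (X_mem_homogeneousSubmodule k l₁) one_pos rfl)).trans
      (Limits.pullback.lift_snd _ _ _)).symm
  rw [hb, hb', Scheme.Hom.toRingHom_comp_specMap, Scheme.Hom.toRingHom_comp_specMap,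
    RingHom.comp_apply, RingHom.comp_apply, RingHom.comp_apply, awayMap_awayRatio_eq_mul, map_mul]

variable {k}

/-- On the intersection of two charts, the dehomogenizations of a multihomogeneous polynomial
divide each other. -/
lemma toRingHom_dehomogenize_dvd {j j' : ∀ i, Fin (n i + 1)} {W : Scheme.{u}}
    (g : W ⟶ Spec (CommRingCat.of (ChartRing k j)))
    (g' : W ⟶ Spec (CommRingCat.of (ChartRing k j'))) (h : g ≫ chart k j = g' ≫ chart k j')
    {f : CoxRing k n} (hf : IsMultihomogeneous f) :
    Scheme.Hom.toRingHom g' (dehomogenize k j' f) ∣ Scheme.Hom.toRingHom g (dehomogenize k j f) := by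
  have hbase := congrArg (· ≫ Limits.WidePullback.base (fun i => projSpaceStr k (n i))) h
  simp only [Category.assoc, chart_base] at hbase
  have hk := congrArg Scheme.Hom.toRingHom hbase
  rw [Scheme.Hom.toRingHom_comp_specMap, Scheme.Hom.toRingHom_comp_specMap] at hk
  -- The two charts induce the same `k`-algebra structure on `Γ(W, ⊤)`, by `hk`.
  let : Algebra k Γ(W, ⊤) :=
    ((Scheme.Hom.toRingHom g).comp (algebraMap k (ChartRing k j))).toAlgebra
  let G : ChartRing k j →ₐ[k] Γ(W, ⊤) := ⟨Scheme.Hom.toRingHom g, fun _ => rfl⟩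
  let G' : ChartRing k j' →ₐ[k] Γ(W, ⊤) :=
    ⟨Scheme.Hom.toRingHom g', fun c => (RingHom.congr_fun hk c).symm⟩
  have hG : ∀ r, Scheme.Hom.toRingHom g (dehomogenize k j r) =
      MvPolynomial.aeval (fun p => Scheme.Hom.toRingHom g
        (dehomogenize k j (MvPolynomial.X p))) r := fun r =>
    DFunLike.congr_fun (MvPolynomial.aeval_unique (G.comp (dehomogenize k j))) r
  have hG' : ∀ r, Scheme.Hom.toRingHom g' (dehomogenize k j' r) =
      MvPolynomial.aeval (fun p => Scheme.Hom.toRingHom g'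
        (dehomogenize k j' (MvPolynomial.X p))) r := fun r =>
    DFunLike.congr_fun (MvPolynomial.aeval_unique (G'.comp (dehomogenize k j'))) r
  -- The two systems of coordinates differ by a factor depending only on the block, so
  -- multihomogeneity turns the change of chart into multiplication by a monomial in these factors.
  have hX : ∀ p : (Σ i : Fin m, Fin (n i + 1)),
      Scheme.Hom.toRingHom g (dehomogenize k j (MvPolynomial.X p)) =
      Scheme.Hom.toRingHom g (dehomogenize k j (MvPolynomial.X ⟨p.1, j' p.1⟩)) *
      Scheme.Hom.toRingHom g' (dehomogenize k j' (MvPolynomial.X p)) := by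
    rintro ⟨i, l⟩
    have hp := congrArg (· ≫ Limits.WidePullback.π (fun i => projSpaceStr k (n i)) i) h
    simp only [Category.assoc, chart_π, chartProj] at hp
    rw [← Category.assoc, ← Category.assoc] at hp
    have h1 := toRingHom_awayRatio_eq_mul k _ _ hp l
    simpa only [Scheme.Hom.toRingHom_comp_specMap, RingHom.comp_apply, chartRingMap_awayRatio]
      using h1
  obtain ⟨d, hd⟩ := hf
  rw [hG, hG', funext hX, aeval_mul_of_isWeightedHomogeneous hd (fun i => Scheme.Hom.toRingHom g
    (dehomogenize k j (MvPolynomial.X ⟨i, j' i⟩)))]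
  exact dvd_mul_left _ _

end Gluing

end MultiProj

/-! ### Ideal sheaves on affine schemes and along open immersions. -/

namespace AlgebraicGeometry.Scheme

lemma IdealSheafData.ofIdealTop_le_ofIdealTop_iff {X : Scheme.{u}} [IsAffine X]
    {I J : Ideal Γ(X, ⊤)} : IdealSheafData.ofIdealTop I ≤ IdealSheafData.ofIdealTop J ↔ I ≤ J :=
  map_le_map_iff (IdealSheafData.equivOfIsAffine (X := X)).symm

lemma IdealSheafData.ofIdealTop_span_singleton_le_ker_iff {X Z : Scheme.{u}} [IsAffine X]
    (q : Z ⟶ X) (a : Γ(X, ⊤)) :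
    IdealSheafData.ofIdealTop (Ideal.span {a}) ≤ q.ker ↔ q.appTop a = 0 := by
  rw [ker_of_isAffine, IdealSheafData.ofIdealTop_le_ofIdealTop_iff, Ideal.span_singleton_le_iff_mem,
    RingHom.mem_ker]

lemma IdealSheafData.comap_ker_of_isOpenImmersion {U Y Z : Scheme.{u}} (c : U ⟶ Y)
    [IsOpenImmersion c] (q : Z ⟶ Y) [QuasiCompact q] :
    q.ker.comap c = (Limits.pullback.fst c q).ker := by
  ext1
  funext W
  rw [IdealSheafData.ideal_comap_of_isOpenImmersion,
    ker_ideal_of_isPullback_of_isOpenImmersion _ _ _ _ (IsPullback.of_hasPullback c q) W]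

lemma IdealSheafData.comap_iInf_of_isOpenImmersion {U Y : Scheme.{u}} {ι : Type*} [Finite ι]
    (I : ι → Y.IdealSheafData) (c : U ⟶ Y) [IsOpenImmersion c] :
    (⨅ i, I i).comap c = ⨅ i, (I i).comap c := by
  ext W x
  simp [IdealSheafData.ideal_comap_of_isOpenImmersion]

end AlgebraicGeometry.Scheme

/-! ### Hypersurfaces and complete intersections on the charts. -/

namespace MultiProj

variable {k : Type u} [Field k] {m : ℕ} {n : Fin m → ℕ}

/-- The ideal sheaf on the chart `U_j` generated by the dehomogenization of `f`. -/
def chartHypersurface (j : ∀ i, Fin (n i + 1)) (f : CoxRing k n) :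
    (Spec (CommRingCat.of (ChartRing k j))).IdealSheafData :=
  Scheme.IdealSheafData.ofIdealTop (Ideal.span
    {(Scheme.ΓSpecIso (CommRingCat.of (ChartRing k j))).inv (dehomogenize k j f)})

lemma chartHypersurface_le_ker_iff {Z : Scheme.{u}} (j : ∀ i, Fin (n i + 1)) (f : CoxRing k n)
    (q : Z ⟶ Spec (CommRingCat.of (ChartRing k j))) :
    chartHypersurface j f ≤ q.ker ↔ Scheme.Hom.toRingHom q (dehomogenize k j f) = 0 :=
  Scheme.IdealSheafData.ofIdealTop_span_singleton_le_ker_iff q _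

lemma hypersurface_le_map (j : ∀ i, Fin (n i + 1)) (f : CoxRing k n) :
    hypersurface f ≤ (chartHypersurface j f).map (chart k j) :=
  iInf_le _ j

/-- The ideal sheaf of a hypersurface restricts on each standard chart to the ideal sheaf generated
by the dehomogenization. -/
lemma comap_hypersurface (j : ∀ i, Fin (n i + 1)) {f : CoxRing k n} (hf : IsMultihomogeneous f) :
    (hypersurface f).comap (chart k j) = chartHypersurface j f := by
  refine le_antisymm (Scheme.IdealSheafData.le_map_iff_comap_le.mp (hypersurface_le_map j f)) ?_
  -- Each member of the infimum is the kernel of the hypersurface of `U_{j'}` mapping to the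
  -- product. Restricted to `U_j`, it is the kernel of the projection from a fibre product, where
  -- the `j'`-dehomogenization of `f` vanishes and divides the `j`-dehomogenization.
  have h : hypersurface f = ⨅ j', ((chartHypersurface j' f).subschemeι ≫ chart k j').ker := rfl
  rw [h, Scheme.IdealSheafData.comap_iInf_of_isOpenImmersion]
  refine le_iInf fun j' => ?_
  rw [Scheme.IdealSheafData.comap_ker_of_isOpenImmersion, chartHypersurface_le_ker_iff]
  have hw := Limits.pullback.condition (f := chart k j)
    (g := (chartHypersurface j' f).subschemeι ≫ chart k j')
  rw [← Category.assoc] at hw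
  refine zero_dvd_iff.mp ?_
  convert toRingHom_dehomogenize_dvd _ _ hw hf
  have h0 : Scheme.Hom.toRingHom (chartHypersurface j' f).subschemeι (dehomogenize k j' f) = 0 := by
    rw [← chartHypersurface_le_ker_iff, Scheme.IdealSheafData.ker_subschemeι]
  rw [Scheme.Hom.toRingHom_comp, RingHom.comp_apply, h0, map_zero]

variable {s : ℕ} {f : Fin s → CoxRing k n}

/-- Pullback of ideal sheaves is a left adjoint, so it commutes with the sum; each summand is
bounded by one member of the infimum defining `hypersurface`. -/
lemma comap_iSup_hypersurface_le (j : ∀ i, Fin (n i + 1)) :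
    (⨆ a, hypersurface (f a)).comap (chart k j) ≤
      Scheme.IdealSheafData.ofIdealTop ((Ideal.span (Set.range fun a =>
        dehomogenize k j (f a))).comap
          (Scheme.ΓSpecIso (CommRingCat.of (ChartRing k j))).hom.hom) := by
  rw [(Scheme.IdealSheafData.map_gc (chart k j)).l_iSup]
  refine iSup_le fun a => (Scheme.IdealSheafData.le_map_iff_comap_le.mp
    (hypersurface_le_map j (f a))).trans ?_
  rw [chartHypersurface, Scheme.IdealSheafData.ofIdealTop_le_ofIdealTop_iff,
    Ideal.span_singleton_le_iff_mem, Ideal.mem_comap]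
  refine Ideal.subset_span ⟨a, ?_⟩
  exact (Iso.inv_hom_id_apply (Scheme.ΓSpecIso (CommRingCat.of (ChartRing k j))) _).symm

lemma dehomogenize_mem_span_of_hypersurface_le {r : CoxRing k n} (hr : IsMultihomogeneous r)
    (h : hypersurface r ≤ ⨆ a, hypersurface (f a)) (j : ∀ i, Fin (n i + 1)) :
    dehomogenize k j r ∈ Ideal.span (Set.range fun a => dehomogenize k j (f a)) := by
  have h1 := (comap_hypersurface j hr).ge.trans
    ((Scheme.IdealSheafData.comap_mono (chart k j) h).trans (comap_iSup_hypersurface_le j))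
  rw [chartHypersurface, Scheme.IdealSheafData.ofIdealTop_le_ofIdealTop_iff,
    Ideal.span_singleton_le_iff_mem, Ideal.mem_comap] at h1
  convert h1
  exact (Iso.inv_hom_id_apply (Scheme.ΓSpecIso (CommRingCat.of (ChartRing k j))) _).symm

/-- The immersion of `Spec (A/p)` into the product factors through the closed subscheme. The factor
is again inducing, and inducing maps do not lower the dimension of the target below that of the
source. -/
lemma ringKrullDim_chartRing_quotient_le (j : ∀ i, Fin (n i + 1)) (p : Ideal (ChartRing k j))
    (hp : ∀ a, dehomogenize k j (f a) ∈ p) :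
    ringKrullDim (ChartRing k j ⧸ p) ≤
      topologicalKrullDim (⨆ a, hypersurface (f a)).subscheme := by
  let i : Spec (CommRingCat.of (ChartRing k j ⧸ p)) ⟶ Spec (CommRingCat.of (ChartRing k j)) :=
    Spec.map (CommRingCat.ofHom (Ideal.Quotient.mk p))
  have hi : IsClosedImmersion i :=
    IsClosedImmersion.spec_of_surjective _ Ideal.Quotient.mk_surjective
  have hle : (⨆ a, hypersurface (f a)) ≤ (i ≫ chart k j).ker := by
    refine iSup_le fun a => (hypersurface_le_map j (f a)).trans ?_
    rw [← Scheme.IdealSheafData.map_ker]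
    refine Scheme.IdealSheafData.map_mono _ ((chartHypersurface_le_ker_iff j (f a) i).mpr ?_)
    have h := Scheme.Hom.toRingHom_comp_specMap (𝟙 _) (Ideal.Quotient.mk p)
    rw [Category.id_comp] at h
    rw [h, RingHom.comp_apply, Ideal.Quotient.eq_zero_iff_mem.mpr (hp a), map_zero]
  let l := IsClosedImmersion.lift (⨆ a, hypersurface (f a)).subschemeι (i ≫ chart k j)
    (by rwa [Scheme.IdealSheafData.ker_subschemeι])
  have hl : l ≫ (⨆ a, hypersurface (f a)).subschemeι = i ≫ chart k j :=
    IsClosedImmersion.lift_fac _ _ _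
  have hind : Topology.IsInducing l := by
    have h := (i ≫ chart k j).isEmbedding.isInducing
    rw [← hl] at h
    exact Topology.IsInducing.of_comp l.continuous
      (⨆ a, hypersurface (f a)).subschemeι.continuous h
  have h := hind.topologicalKrullDim_le
  refine le_trans (ge_of_eq ?_) h
  exact PrimeSpectrum.topologicalKrullDim_eq_ringKrullDim _

lemma chartMonomial_mem_irrelevantIdeal (j : ∀ i, Fin (n i + 1)) :
    chartMonomial k j ∈ irrelevantIdeal k n :=
  Ideal.prod_mem_prod fun i _ => Ideal.subset_span ⟨j i, rfl⟩

/-- If the hypersurfaces `f_1, …, f_s` form a complete intersection, membership in the ideal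
`(f_1, …, f_s)` can be checked on the standard charts. -/
lemma mem_span_of_isCompleteIntersection (hs : ∀ i, s ≤ n i) (hf : ∀ a, IsMultihomogeneous (f a))
    {X : (multiProjSpace k n).IdealSheafData}
    (hX : X.IsCompleteIntersection fun a => hypersurface (f a)) {r : CoxRing k n}
    (hr : ∀ j, ∃ N, chartMonomial k j ^ N * r ∈ Ideal.span (Set.range f)) :
    r ∈ Ideal.span (Set.range f) := by
  refine mem_span_of_forall_chartMonomial_pow_mul_mem hs hf (fun j p _ hfp => ?_) hr
  obtain ⟨rfl, hdim⟩ := hX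
  calc ringKrullDim (ChartRing k j ⧸ p) + s
      ≤ topologicalKrullDim (⨆ a, hypersurface (f a)).subscheme + s := by
        gcongr
        exact ringKrullDim_chartRing_quotient_le j p hfp
    _ = topologicalKrullDim (multiProjSpace k n) := hdim
    _ ≤ _ := topologicalKrullDim_multiProjSpace_le k n

end MultiProj

end

theorem proposition4p3 (k : Type u) [Field k] (m : ℕ) (n : Fin m → ℕ) (hn : ∀ i, 1 ≤ n i)
    (s : ℕ) (hs : ∀ i, s ≤ n i) (f : Fin s → MultiProj.CoxRing k n)
    (hf : ∀ a, MultiProj.IsMultihomogeneous (f a))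
    (X : (MultiProj.multiProjSpace k n).IdealSheafData)
    (hX : X.IsCompleteIntersection (fun a => MultiProj.hypersurface (f a))) :
    (Ideal.span (Set.range f)).IsSaturatedBy (MultiProj.irrelevantIdeal k n) ∧
      MultiProj.IsStrictCompleteIntersection X f := by
  refine ⟨le_antisymm ?_ ?_, hX, le_antisymm ?_ ?_⟩
  · rintro r ⟨N, hN⟩
    refine MultiProj.mem_span_of_isCompleteIntersection hs hf hX fun j => ⟨N, ?_⟩
    rw [mul_comm]
    exact hN _ (Ideal.pow_mem_pow (MultiProj.chartMonomial_mem_irrelevantIdeal j) N)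
  · exact fun r hr => ⟨0, fun g _ => Ideal.mul_mem_right g _ hr⟩
  · refine Ideal.span_le.mpr fun r hr => ?_
    refine MultiProj.mem_span_of_isCompleteIntersection hs hf hX fun j => ?_
    exact MultiProj.exists_chartMonomial_pow_mul_mem j hf hr.1
      (MultiProj.dehomogenize_mem_span_of_hypersurface_le hr.1 (hr.2.trans hX.1.le) j)
  · rw [Ideal.span_le]
    rintro _ ⟨a, rfl⟩
    exact Ideal.subset_span ⟨hf a, (le_iSup (fun a => MultiProj.hypersurface (f a)) a).trans hX.1.ge⟩
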